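/- Let $\|\cdot\|$ be the spectral norm and $\kappa(A)=\sigma_{\max}(A)/\sigma_{\min}(A)$ the 2-norm condition number of a matrix with at least as many rows as columns ($\kappa(A)=\infty$ if $A$ does not have full column rank). Floating-point arithmetic with unit roundoff $\varepsilon>0$ means the standard model: each elementary operation $+,-,\times,/,\sqrt{\ }$ returns its exact result times $1+\delta$ with some $|\delta|\le\varepsilon$; sums and inner products may be evaluated in any order. **Algorithms.** Let $\mathcal X=[X_1,\dots,X_p]\in\mathbb R^{m\times ps}$ with blocks $X_k\in\mathbb R^{m\times s}$, where $p,s\ge1$ and $ps\le m$, and let $\mathrm{IO}$ be a routine that maps each $X\in\mathbb R^{m\times s}$ to a pair $[\bar Q,\bar R]=\mathrm{IO}(X)$ with $\bar Q\in\mathbb R^{m\times s}$, $\bar R\in\mathbb R^{s\times s}$. $[\mathcal Q,\mathcal R]=\mathrm{BCGS\text{-}PIP}(\mathcal X,\mathrm{IO})$ sets $[Q_1,R_{11}]=\mathrm{IO}(X_1)$ and, for $k=2,\dots,p$, $$\mathcal R_{1:k-1,k}=\mathcal Q_{1:k-1}^TX_k,\quad P_k=X_k^TX_k,\quad R_{kk}=\mathrm{chol}\bigl(P_k-\mathcal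 R_{1:k-1,k}^T\mathcal R_{1:k-1,k}\bigr),$$ $$V_k=X_k-\mathcal Q_{1:k-1}\mathcal R_{1:k-1,k},\quad Q_k=V_kR_{kk}^{-1},$$ with zero blocks of $\mathcal R$ below the block diagonal; here $\mathrm{chol}$ is the upper triangular Cholesky factor, computed by the usual recursion with positive radicands (i.e. without breakdown), and $V_kR_{kk}^{-1}$ is computed by substitution. $[\mathcal Q,\mathcal R]=\mathrm{BCGS\text{-}PIP{+}}(\mathcal X,\mathrm{IO})$ is: $[\mathcal U,\mathcal S]=\mathrm{BCGS\text{-}PIP}(\mathcal X,\mathrm{IO})$, $[\mathcal Q,\mathcal T]=\mathrm{BCGS\text{-}PIP}(\mathcal U,\mathrm{IO})$, $\mathcal R=\mathcal T\mathcal S$. **Statement.** There are real polynomials $c_0,c_1,C$ in three variables such that the following holds for all $m,p,s$ as above, all $\varepsilon>0$ and $a\ge0$, all $\mathrm{IO}$ and all $\mathcal X\in\mathbb R^{m\times ps}$; write $c_0=c_0(m,ps,a)$, and likewise $c_1,C$. Suppose that $c_0\,\varepsilon\,\kappa^2(\mathcal X)\le\frac12$, and that for every $X\in\mathbb R^{m\times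 s}$ with $\kappa(X)\le(1+c_1\varepsilon)\,\kappa(\mathcal X)$ the output $[\bar Q,\bar R]=\mathrm{IO}(X)$ satisfies $$\bar R^T\bar R=X^TX+\Delta E,\quad\|\Delta E\|\le a\,\varepsilon\,\|X\|^2,$$ $$\bar Q\bar R=X+\Delta D,\quad\|\Delta D\|\le a\,\varepsilon\,\bigl(\|X\|+\|\bar Q\|\,\|\bar R\|\bigr).$$ If $\bar{\mathcal Q},\bar{\mathcal R}$ are computed by $\mathrm{BCGS\text{-}PIP{+}}(\mathcal X,\mathrm{IO})$ in floating-point arithmetic with unit roundoff $\varepsilon$, then $$\bar{\mathcal R}^T\bar{\mathcal R}=\mathcal X^T\mathcal X+\Delta\mathcal E,\qquad\|\Delta\mathcal E\|\le C\,\varepsilon\,\|\mathcal X\|^2 .$$ -/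

import Mathlib

open scoped Matrix.Norms.L2Operator

noncomputable section

namespace BlockGS

/-! ### Norms and conditioning

`‖A‖` is the matrix norm induced by the Euclidean norms (the spectral norm). -/

/-- The smallest singular value `min_{‖x‖ = 1} ‖A x‖` of a matrix with at least as many rows as
columns. -/
def sigmaMin {m n : Type*} [Fintype m] [Fintype n] [DecidableEq n] (A : Matrix m n ℝ) : ℝ :=
  ⨅ x : Metric.sphere (0 : EuclideanSpace ℝ n) 1, ‖Matrix.toEuclideanLin A x.1‖

/-- The 2-norm condition number `σ_max(A) / σ_min(A)`; it is `∞` when `A` does not have full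
column rank. -/
def cond {m n : Type*} [Fintype m] [Fintype n] [DecidableEq n] (A : Matrix m n ℝ) : ENNReal :=
  if sigmaMin A = 0 then ⊤ else ENNReal.ofReal (‖A‖ / sigmaMin A)

/-! ### Floating-point arithmetic

The standard model with unit roundoff `ε`: every elementary operation (`+`, `-`, `*`, `/`, `√`)
returns its exact result times `1 + δ` for some `|δ| ≤ ε`. The errors `δ` of different operations
are unrelated, and the terms of sums and inner products may be added in any order. -/

/-- `y` is a rounded value of the exact result `x` of one elementary operation. -/
def Rounds (ε x y : ℝ) : Prop := ∃ δ : ℝ, |δ| ≤ ε ∧ y = x * (1 + δ)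

/-- `FlSum ε t c`: `c` is a computed value of the sum of the terms in the multiset `t`, the
additions being carried out in some order (along some binary tree). -/
inductive FlSum (ε : ℝ) : Multiset ℝ → ℝ → Prop
  | zero : FlSum ε 0 0
  | single (a : ℝ) : FlSum ε {a} a
  | add {t u : Multiset ℝ} {a b c : ℝ} : t ≠ 0 → u ≠ 0 → FlSum ε t a → FlSum ε u b →
      Rounds ε (a + b) c → FlSum ε (t + u) c

/-- `c` is a computed value of `∑ i ∈ t, x i * y i`. -/
def FlDot {ι : Type*} (ε : ℝ) (t : Finset ι) (x y : ι → ℝ) (c : ℝ) : Prop :=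
  ∃ z : ι → ℝ, (∀ i ∈ t, Rounds ε (x i * y i) (z i)) ∧ FlSum ε (t.val.map z) c

/-- `c` is a computed value of `a - ∑ i ∈ t, x i * y i`. -/
def FlSubDot {ι : Type*} (ε : ℝ) (a : ℝ) (t : Finset ι) (x y : ι → ℝ) (c : ℝ) : Prop :=
  ∃ z : ι → ℝ, (∀ i ∈ t, Rounds ε (x i * y i) (z i)) ∧
    FlSum ε (a ::ₘ t.val.map fun i => -z i) c

/-- `C` is a computed value of the matrix product `A * B`. -/
def FlMul {l n r : Type*} [Fintype n] (ε : ℝ) (A : Matrix l n ℝ) (B : Matrix n r ℝ)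
    (C : Matrix l r ℝ) : Prop :=
  ∀ i j, FlDot ε Finset.univ (fun k => A i k) (fun k => B k j) (C i j)

/-- `C` is a computed value of the matrix difference `A - B`. -/
def FlSub {l r : Type*} (ε : ℝ) (A B C : Matrix l r ℝ) : Prop :=
  ∀ i j, Rounds ε (A i j - B i j) (C i j)

/-- `R` is the upper triangular factor computed by a successful run of the Cholesky factorization
of the symmetric matrix stored in the upper triangle of `A`:
`R i j = (A i j - ∑_{l < i} R l i * R l j) / R i i` for `i < j`, and
`R j j = √(A j j - ∑_{l < j} R l j ^ 2)`, where the computed radicand has to be positive. -/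
def FlChol {s : ℕ} (ε : ℝ) (A R : Matrix (Fin s) (Fin s) ℝ) : Prop :=
  (∀ i j, j < i → R i j = 0) ∧
  (∀ i j, i < j → ∃ t, FlSubDot ε (A i j) (Finset.Iio i) (fun l => R l i) (fun l => R l j) t ∧
    Rounds ε (t / R i i) (R i j)) ∧
  (∀ j, ∃ t, FlSubDot ε (A j j) (Finset.Iio j) (fun l => R l j) (fun l => R l j) t ∧
    0 < t ∧ Rounds ε (√t) (R j j))

/-- `Q` is the value of `V * R⁻¹`, for `R` upper triangular, computed by substitution:
`Q i j = (V i j - ∑_{l < j} Q i l * R l j) / R j j`. -/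
def FlTriSolve {m s : ℕ} (ε : ℝ) (V : Matrix (Fin m) (Fin s) ℝ) (R : Matrix (Fin s) (Fin s) ℝ)
    (Q : Matrix (Fin m) (Fin s) ℝ) : Prop :=
  ∀ i j, ∃ t, FlSubDot ε (V i j) (Finset.Iio j) (fun l => Q i l) (fun l => R l j) t ∧
    Rounds ε (t / R j j) (Q i j)

/-! ### The algorithms

A matrix with `p` block columns of width `s` has its columns indexed by `Fin p × Fin s`. -/

/-- The `k`-th block vector of `X`. -/
def blockCol {m p s : ℕ} (X : Matrix (Fin m) (Fin p × Fin s) ℝ) (k : Fin p) :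
    Matrix (Fin m) (Fin s) ℝ :=
  fun i b => X i (k, b)

/-- The `s × s` block in position `(l, k)` of `R`. -/
def block {p s : ℕ} (R : Matrix (Fin p × Fin s) (Fin p × Fin s) ℝ) (l k : Fin p) :
    Matrix (Fin s) (Fin s) ℝ :=
  fun a b => R (l, a) (k, b)

/-- The column indices that belong to the block vectors preceding the `k`-th one. -/
def before {p : ℕ} (s : ℕ) (k : Fin p) : Finset (Fin p × Fin s) :=
  Finset.univ.filter fun x => x.1 < k

/-- One iteration (not the first) of BCGS-PIP in floating-point arithmetic, for block `k`.
The intermediate quantities are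
`P = Xₖᵀ Xₖ`, `W = R_{1:k-1,k}ᵀ R_{1:k-1,k}`, `A = P - W`, `Z = Q_{1:k-1} R_{1:k-1,k}` and
`V = Xₖ - Z`. -/
def FlPIPStep {m p s : ℕ} (ε : ℝ) (X Q : Matrix (Fin m) (Fin p × Fin s) ℝ)
    (R : Matrix (Fin p × Fin s) (Fin p × Fin s) ℝ) (k : Fin p) : Prop :=
  ∃ (P W A : Matrix (Fin s) (Fin s) ℝ) (Z V : Matrix (Fin m) (Fin s) ℝ),
    (∀ l < k, FlMul ε (blockCol Q l).transpose (blockCol X k) (block R l k)) ∧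
    FlMul ε (blockCol X k).transpose (blockCol X k) P ∧
    (∀ a b, FlDot ε (before s k) (fun x => R x (k, a)) (fun x => R x (k, b)) (W a b)) ∧
    FlSub ε P W A ∧
    FlChol ε A (block R k k) ∧
    (∀ i b, FlDot ε (before s k) (fun x => Q i x) (fun x => R x (k, b)) (Z i b)) ∧
    FlSub ε (blockCol X k) Z V ∧
    FlTriSolve ε V (block R k k) (blockCol Q k)

/-- `[Q, R] = BCGS-PIP(X, intraOrtho)` in floating-point arithmetic with unit roundoff `ε`: the pair
`(Q, R)` is a possible outcome of a run. -/
def FlPIP {m p s : ℕ} (ε : ℝ)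
    (intraOrtho : Matrix (Fin m) (Fin s) ℝ → Matrix (Fin m) (Fin s) ℝ × Matrix (Fin s) (Fin s) ℝ)
    (X Q : Matrix (Fin m) (Fin p × Fin s) ℝ)
    (R : Matrix (Fin p × Fin s) (Fin p × Fin s) ℝ) : Prop :=
  (∀ l k, k < l → block R l k = 0) ∧
  (∀ k : Fin p, k.val = 0 → (blockCol Q k, block R k k) = intraOrtho (blockCol X k)) ∧
  (∀ k : Fin p, 0 < k.val → FlPIPStep ε X Q R k)

/-- `[Q, R] = BCGS-PIP+(X, intraOrtho)` in floating-point arithmetic with unit roundoff `ε`: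
`[U, S] = BCGS-PIP(X, intraOrtho)`, `[Q, T] = BCGS-PIP(U, intraOrtho)`, `R = T S`. -/
def FlPIPPlus {m p s : ℕ} (ε : ℝ)
    (intraOrtho : Matrix (Fin m) (Fin s) ℝ → Matrix (Fin m) (Fin s) ℝ × Matrix (Fin s) (Fin s) ℝ)
    (X Q : Matrix (Fin m) (Fin p × Fin s) ℝ)
    (R : Matrix (Fin p × Fin s) (Fin p × Fin s) ℝ) : Prop :=
  ∃ (U : Matrix (Fin m) (Fin p × Fin s) ℝ) (S T : Matrix (Fin p × Fin s) (Fin p × Fin s) ℝ),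
    FlPIP ε intraOrtho X U S ∧ FlPIP ε intraOrtho U Q T ∧ FlMul ε T S R

/-- `intraOrtho` is an intraorthogonalization routine, returning computed factors `(Q, R)`.
The requirement on one call `[Q, R] = intraOrtho(X)`: Cholesky residual at most `η ‖X‖²` and residual
at most `η (‖X‖ + ‖Q‖ ‖R‖)`. -/
def IntraOrthoAccurate {m s : ℕ} (η : ℝ)
    (intraOrtho : Matrix (Fin m) (Fin s) ℝ → Matrix (Fin m) (Fin s) ℝ × Matrix (Fin s) (Fin s) ℝ)
    (X : Matrix (Fin m) (Fin s) ℝ) : Prop :=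
  (∃ ΔE : Matrix (Fin s) (Fin s) ℝ,
    (intraOrtho X).2.transpose * (intraOrtho X).2 = X.transpose * X + ΔE ∧ ‖ΔE‖ ≤ η * ‖X‖ ^ 2) ∧
  (∃ ΔD : Matrix (Fin m) (Fin s) ℝ,
    (intraOrtho X).1 * (intraOrtho X).2 = X + ΔD ∧ ‖ΔD‖ ≤ η * (‖X‖ + ‖(intraOrtho X).1‖ * ‖(intraOrtho X).2‖))

end BlockGS

end

noncomputable section

namespace BlockGS

/-! ### Rounding errors of sums, inner products and substitution steps -/

/-! Put `N = 1 + m + ps + a` and `κ = ‖X‖ / sigmaMin X`. If one pass of BCGS-PIP gives `QR = X + D`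
and `RᵀR = XᵀX + E` with `D = O(ε‖X‖)` and `E = O(ε‖X‖²)`, then `R` is invertible and `Q` is an
isometry up to `O(εκ²)` (`abs_norm_toEuclideanLin_sub_norm_le`). Applied to the first pass, this
makes `U` nearly orthonormal, so the intraorthogonalization hypothesis also covers the first block
of `U` and the second pass yields `TᵀT = UᵀU + E'`. With `R = TS + F`, the Gram matrix `RᵀR` equals
`(X + D)ᵀ(X + D) + SᵀE'S` up to terms in `F`. No power of `κ` survives, because `‖S‖ = O(‖X‖)` and
`‖T‖ = O(1)`.

The real difficulty is one pass (`FlPIP.error_bounds`): the errors `D` and `E` depend on the size of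
the computed `Q`, which is controlled only through `D` and `E`. The loop is broken by induction over
blocks (`PIPBounds.abs_basis_le_two`). The Gram error of the leading `k` blocks needs only earlier
blocks of `Q`, and the residual is affine in the largest entry of `Q` with a small slope, so that
entry can be solved for. All estimates are entrywise; passing to norms costs only powers of `N`. -/

theorem Rounds.abs_sub_le {ε x y : ℝ} (h : Rounds ε x y) : |y - x| ≤ ε * |x| := by
  obtain ⟨δ, hδ, rfl⟩ := h
  have : x * (1 + δ) - x = δ * x := by ring
  rw [this, abs_mul]
  exact mul_le_mul_of_nonneg_right hδ (abs_nonneg _)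

theorem abs_multiset_sum_le (t : Multiset ℝ) : |t.sum| ≤ (t.map abs).sum :=
  Multiset.le_sum_of_subadditive abs abs_zero.le abs_add_le t

theorem FlSum.abs_sub_le {ε : ℝ} (hε : 0 ≤ ε) {t : Multiset ℝ} {c : ℝ} (h : FlSum ε t c) :
    |c - t.sum| ≤ ((1 + ε) ^ t.card - 1) * (t.map abs).sum := by
  induction h with
  | zero => simp
  | single a => simpa using mul_nonneg hε (abs_nonneg a)
  | @add t u a b c ht hu _ _ hc iha ihb =>
    -- Because the other summand is nonempty, the exponent grows by at least one, which pays for the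
    -- rounding of this addition. Hence the bound is the same for every order of summation.
    have key : ∀ (t u : Multiset ℝ) (a : ℝ), u ≠ 0 →
        |a - t.sum| ≤ ((1 + ε) ^ t.card - 1) * (t.map abs).sum →
        |a - t.sum| + ε * |a| ≤ ((1 + ε) ^ (t.card + u.card) - 1) * (t.map abs).sum := by
      intro t u a hu h
      have hS : 0 ≤ (t.map abs).sum := (abs_nonneg _).trans (abs_multiset_sum_le t)
      have ha : |a| ≤ (1 + ε) ^ t.card * (t.map abs).sum := by
        have h1 := abs_multiset_sum_le t
        have h2 : |a| ≤ |a - t.sum| + |t.sum| := by simpa using abs_add_le (a - t.sum) t.sum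
        linarith
      have hp : (1 + ε) ^ (t.card + 1) ≤ (1 + ε) ^ (t.card + u.card) :=
        pow_le_pow_right₀ (by linarith)
          (Nat.add_le_add_left (Nat.one_le_iff_ne_zero.2 (by simpa using hu)) _)
      have h3 := mul_le_mul_of_nonneg_left ha hε
      have h4 := mul_le_mul_of_nonneg_right hp hS
      rw [pow_succ] at h4
      linarith
    have h1 := key t u a hu iha
    have h2 := key u t b ht ihb
    have h3 := hc.abs_sub_le
    have h4 := mul_le_mul_of_nonneg_left (abs_add_le a b) hε
    have h5 : |c - (t + u).sum| ≤ |c - (a + b)| + (|a - t.sum| + |b - u.sum|) := by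
      have : c - (t + u).sum = (c - (a + b)) + ((a - t.sum) + (b - u.sum)) := by
        rw [Multiset.sum_add]; ring
      rw [this]
      exact (abs_add_le _ _).trans (add_le_add le_rfl (abs_add_le _ _))
    rw [Multiset.card_add, Multiset.map_add]
    simp only [Multiset.sum_add] at h5 ⊢
    rw [add_comm u.card] at h2
    linarith

/-- `g` bounds the accumulated relative error of `L` successive operations. -/
structure ErrorBound (ε : ℝ) (L : ℕ) (g : ℝ) : Prop where
  eps_nonneg : 0 ≤ ε
  eps_le : ε ≤ g
  pow_le : (1 + ε) ^ L ≤ 1 + g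
  le : g ≤ 1 / 40

theorem ErrorBound.nonneg {ε g : ℝ} {L : ℕ} (h : ErrorBound ε L g) : 0 ≤ g :=
  h.eps_nonneg.trans h.eps_le

theorem errorBound_of_mul_le {ε g : ℝ} {L : ℕ} (hε : 0 ≤ ε) (hL : 1 ≤ L) (h : 2 * L * ε ≤ g)
    (hg : g ≤ 1 / 40) : ErrorBound ε L g := by
  have hL' : (1 : ℝ) ≤ L := by exact_mod_cast hL
  refine ⟨hε, by nlinarith, ?_, hg⟩
  have h1 : (1 + ε) ^ L ≤ Real.exp (L * ε) := by
    rw [Real.exp_nat_mul]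
    exact pow_le_pow_left₀ (by linarith) (by linarith [Real.add_one_le_exp ε]) _
  have h0 : 0 ≤ L * ε := by positivity
  -- Here `|exp x - 1| ≤ 2|x|` for `|x| ≤ 1`; this is the factor 2 in the hypothesis on `g`.
  have h2 := Real.abs_exp_sub_one_le (x := L * ε) (by rw [abs_of_nonneg h0]; linarith)
  rw [abs_of_nonneg h0] at h2
  linarith [le_abs_self (Real.exp (L * ε) - 1)]

theorem ErrorBound.sum_round {ε g : ℝ} {L : ℕ} (hg : ErrorBound ε L g) {t : Multiset ℝ}
    {c u S : ℝ} (h : FlSum ε t c) (hL : t.card + 1 ≤ L) (ht : (t.map abs).sum ≤ (1 + ε) * S)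
    (hd : |t.sum - u| ≤ ε * S) (hS : 0 ≤ S) : |c - u| ≤ g * S := by
  have h1 := h.abs_sub_le hg.eps_nonneg
  have h2 : (1 : ℝ) ≤ (1 + ε) ^ t.card := one_le_pow₀ (by linarith [hg.eps_nonneg])
  have h3 := mul_le_mul_of_nonneg_left ht (sub_nonneg.2 h2)
  have h4 : (1 + ε) ^ (t.card + 1) ≤ (1 + ε) ^ L :=
    pow_le_pow_right₀ (by linarith [hg.eps_nonneg]) hL
  have h5 := mul_le_mul_of_nonneg_right (h4.trans hg.pow_le) hS
  rw [pow_succ] at h5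
  have h6 := _root_.abs_sub_le c t.sum u
  linarith

theorem abs_sum_mul_sub_le {ι : Type*} {ε : ℝ} (t : Finset ι) {x y z : ι → ℝ}
    (hz : ∀ i ∈ t, Rounds ε (x i * y i) (z i)) :
    |∑ i ∈ t, z i - ∑ i ∈ t, x i * y i| ≤ ε * ∑ i ∈ t, |x i| * |y i| := by
  rw [← Finset.sum_sub_distrib, Finset.mul_sum]
  refine (Finset.abs_sum_le_sum_abs _ _).trans (Finset.sum_le_sum fun i hi => ?_)
  simpa [abs_mul] using (hz i hi).abs_sub_le

theorem sum_abs_rounds_le {ι : Type*} {ε : ℝ} (t : Finset ι) {x y z : ι → ℝ}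
    (hz : ∀ i ∈ t, Rounds ε (x i * y i) (z i)) :
    ∑ i ∈ t, |z i| ≤ (1 + ε) * ∑ i ∈ t, |x i| * |y i| := by
  rw [Finset.mul_sum]
  refine Finset.sum_le_sum fun i hi => ?_
  have h1 := (hz i hi).abs_sub_le
  have h2 : |z i| ≤ |z i - x i * y i| + |x i * y i| := by
    simpa using abs_add_le (z i - x i * y i) (x i * y i)
  rw [abs_mul] at h1 h2
  linarith

theorem FlDot.abs_sub_le {ι : Type*} {ε g : ℝ} {L : ℕ} (hg : ErrorBound ε L g) {t : Finset ι}
    {x y : ι → ℝ} {c : ℝ} (h : FlDot ε t x y c) (hL : t.card + 1 ≤ L) :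
    |c - ∑ i ∈ t, x i * y i| ≤ g * ∑ i ∈ t, |x i| * |y i| := by
  obtain ⟨z, hz, hc⟩ := h
  refine hg.sum_round hc (by simpa using hL) ?_ ?_ (Finset.sum_nonneg fun _ _ => by positivity)
  · rw [Multiset.map_map]
    exact sum_abs_rounds_le t hz
  · exact abs_sum_mul_sub_le t hz

theorem FlSubDot.abs_sub_le {ι : Type*} {ε g : ℝ} {L : ℕ} (hg : ErrorBound ε L g) {a : ℝ}
    {t : Finset ι} {x y : ι → ℝ} {c : ℝ} (h : FlSubDot ε a t x y c) (hL : t.card + 2 ≤ L) :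
    |c - (a - ∑ i ∈ t, x i * y i)| ≤ g * (|a| + ∑ i ∈ t, |x i| * |y i|) := by
  obtain ⟨z, hz, hc⟩ := h
  have hB : 0 ≤ ∑ i ∈ t, |x i| * |y i| := Finset.sum_nonneg fun _ _ => by positivity
  have hε := hg.eps_nonneg
  have h1 := abs_sum_mul_sub_le t hz
  have h2 := sum_abs_rounds_le t hz
  have h3 := mul_nonneg hε (abs_nonneg a)
  have e1 : (t.val.map fun i => -z i).sum = -∑ i ∈ t, z i := by
    rw [← Finset.sum_neg_distrib]; rfl
  have e2 : ((t.val.map fun i => -z i).map abs).sum = ∑ i ∈ t, |z i| := by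
    rw [Multiset.map_map]
    exact Finset.sum_congr rfl fun i _ => abs_neg (z i)
  refine hg.sum_round hc (by simp; omega)
    (by rw [Multiset.map_cons, Multiset.sum_cons, e2]; linarith) ?_ (by positivity)
  rw [Multiset.sum_cons, e1]
  rw [abs_sub_comm] at h1
  calc _ = |∑ i ∈ t, x i * y i - ∑ i ∈ t, z i| := by congr 1; ring
    _ ≤ _ := by linarith

/-- Error of a computed difference of two computed quantities. -/
theorem ErrorBound.sub_le {ε g : ℝ} {L : ℕ} (hg : ErrorBound ε L g) {p p₀ P w w₀ W A : ℝ}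
    (hA : Rounds ε (p - w) A) (hp : |p - p₀| ≤ g * P) (hw : |w - w₀| ≤ g * W)
    (hP : |p₀| ≤ P) (hW : |w₀| ≤ W) : |A - (p₀ - w₀)| ≤ 3 * g * (P + W) := by
  have h0 := hg.nonneg
  have hP0 := (abs_nonneg _).trans hP
  have hW0 := (abs_nonneg _).trans hW
  have h1 : |p - w| ≤ (1 + g) * (P + W) := by
    rw [abs_le] at *
    constructor <;> linarith
  have h2 : |A - (p - w)| ≤ g * ((1 + g) * (P + W)) :=
    hA.abs_sub_le.trans (mul_le_mul hg.eps_le h1 (abs_nonneg _) h0)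
  have h3 : g * ((1 + g) * (P + W)) ≤ 2 * g * (P + W) := by
    have : 0 ≤ g * (P + W) := by positivity
    nlinarith [hg.le]
  rw [abs_le] at *
  constructor <;> linarith

/-- Error of one step of the substitution or of the Cholesky recursion: `ρ` is the product of the
computed entry with the pivot. -/
theorem ErrorBound.recursion_le {ε g : ℝ} {L : ℕ} (hg : ErrorBound ε L g)
    {A p₀ w₀ G τ σ B ρ : ℝ} (hA : |A - (p₀ - w₀)| ≤ 3 * g * G) (hG : |p₀ - w₀| ≤ G)
    (hτ : |τ - (A - σ)| ≤ g * (|A| + B)) (hσ : |σ| ≤ B) (hρ : |ρ - τ| ≤ 3 * g * |τ|) :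
    |w₀ + σ + ρ - p₀| ≤ 10 * g * (G + B) := by
  have h0 := hg.nonneg
  have hle := hg.le
  have hG0 := (abs_nonneg _).trans hG
  have hB0 := (abs_nonneg _).trans hσ
  have hA' : |A| ≤ (1 + 3 * g) * G := by
    rw [abs_le] at *
    constructor <;> linarith
  have hτ' : |τ| ≤ (1 + g) * (|A| + B) := by
    have h2 : |A - σ| ≤ |A| + B := (abs_sub _ _).trans (by linarith)
    have h3 : |τ| ≤ |τ - (A - σ)| + |A - σ| := by simpa using abs_add_le (τ - (A - σ)) (A - σ)
    linarith
  have h1 : g * (|A| + B) ≤ g * ((1 + 3 * g) * G + B) := by gcongr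
  have h2 : 3 * g * |τ| ≤ 3 * g * ((1 + g) * ((1 + 3 * g) * G + B)) := by
    gcongr
    exact hτ'.trans (by gcongr)
  have h3 : w₀ + σ + ρ - p₀ = (ρ - τ) + (τ - (A - σ)) + (A - (p₀ - w₀)) := by ring
  rw [h3]
  refine (abs_add_three _ _ _).trans ?_
  have h4 : 0 ≤ g * G := by positivity
  have h5 : 0 ≤ g * B := by positivity
  have h6 : (1 + g) * (1 + 3 * g) ≤ 6 / 5 := by nlinarith
  have h7 : g * G * ((1 + g) * (1 + 3 * g)) ≤ g * G * (6 / 5) := by gcongr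
  have h8 : g * G * g ≤ g * G * (1 / 40) := by gcongr
  have h9 : g * B * g ≤ g * B * (1 / 40) := by gcongr
  nlinarith

/-! ### Spectral norm, entries and singular values -/

section Norms

variable {m n : Type*} [Fintype m] [Fintype n] [DecidableEq n]

theorem norm_toEuclideanLin_le (A : Matrix m n ℝ) (x : EuclideanSpace ℝ n) :
    ‖Matrix.toEuclideanLin A x‖ ≤ ‖A‖ * ‖x‖ :=
  Matrix.l2_opNorm_mulVec A x

theorem norm_le_of_forall_toEuclideanLin_le {A : Matrix m n ℝ} {c : ℝ} (hc : 0 ≤ c)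
    (h : ∀ x, ‖Matrix.toEuclideanLin A x‖ ≤ c * ‖x‖) : ‖A‖ ≤ c := by
  rw [Matrix.l2_opNorm_def]
  exact ContinuousLinearMap.opNorm_le_bound _ hc h

theorem toEuclideanLin_single_apply {m n : Type*} [Fintype n] [DecidableEq n]
    (A : Matrix m n ℝ) (i : m) (j : n) :
    Matrix.toEuclideanLin A (EuclideanSpace.single j 1) i = A i j := by
  simp [Matrix.toLpLin_apply]

theorem abs_entry_le_norm_column (A : Matrix m n ℝ) (i : m) (j : n) :
    |A i j| ≤ ‖Matrix.toEuclideanLin A (EuclideanSpace.single j 1)‖ := by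
  rw [← toEuclideanLin_single_apply A i j]
  exact PiLp.norm_apply_le (Matrix.toEuclideanLin A (EuclideanSpace.single j 1)) i

theorem abs_entry_le_norm (A : Matrix m n ℝ) (i : m) (j : n) : |A i j| ≤ ‖A‖ := by
  refine (abs_entry_le_norm_column A i j).trans ((norm_toEuclideanLin_le A _).trans ?_)
  simp

theorem norm_single_le [DecidableEq m] (i : m) (j : n) (a : ℝ) : ‖Matrix.single i j a‖ ≤ |a| := by
  refine norm_le_of_forall_toEuclideanLin_le (abs_nonneg a) fun x => ?_
  have : Matrix.toEuclideanLin (Matrix.single i j a) x = EuclideanSpace.single i (a * x j) := by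
    ext k
    simp [Matrix.toLpLin_apply, Matrix.single_mulVec, Function.update_apply]
  rw [this, PiLp.norm_single, norm_mul, Real.norm_eq_abs]
  exact mul_le_mul_of_nonneg_left (PiLp.norm_apply_le x j) (abs_nonneg a)

/-- A crude triangle inequality over single-entry matrices. The lost dimension factors are harmless
since the final constants are polynomials. -/
theorem norm_le_of_forall_abs_entry_le {A : Matrix m n ℝ} {c : ℝ} (h : ∀ i j, |A i j| ≤ c) :
    ‖A‖ ≤ Fintype.card m * Fintype.card n * c := by
  classical
  rw [Matrix.matrix_eq_sum_single A]
  calc _ ≤ ∑ i : m, ∑ j : n, ‖Matrix.single i j (A i j)‖ :=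
        (norm_sum_le _ _).trans (Finset.sum_le_sum fun i _ => norm_sum_le _ _)
    _ ≤ ∑ i : m, ∑ j : n, c :=
        Finset.sum_le_sum fun i _ => Finset.sum_le_sum fun j _ => (norm_single_le i j _).trans (h i j)
    _ = _ := by simp; ring

theorem norm_transpose_eq [DecidableEq m] (A : Matrix m n ℝ) : ‖A.transpose‖ = ‖A‖ := by
  rw [← Matrix.conjTranspose_eq_transpose_of_trivial, Matrix.l2_opNorm_conjTranspose]

theorem toEuclideanLin_mul {m n l : Type*} [Fintype n] [DecidableEq n] [Fintype l]
    [DecidableEq l] (A : Matrix m n ℝ)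
    (B : Matrix n l ℝ) (x : EuclideanSpace ℝ l) :
    Matrix.toEuclideanLin (A * B) x = Matrix.toEuclideanLin A (Matrix.toEuclideanLin B x) := by
  simp [Matrix.toLpLin_apply, Matrix.mulVec_mulVec]

theorem norm_sq_toEuclideanLin [DecidableEq m] (A : Matrix m n ℝ) (x : EuclideanSpace ℝ n) :
    ‖Matrix.toEuclideanLin A x‖ ^ 2 =
      inner ℝ x (Matrix.toEuclideanLin (A.transpose * A) x) := by
  rw [toEuclideanLin_mul, ← real_inner_self_eq_norm_sq]
  have := Matrix.toEuclideanLin_conjTranspose_eq_adjoint A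
  rw [Matrix.conjTranspose_eq_transpose_of_trivial] at this
  rw [this, LinearMap.adjoint_inner_right]

theorem sigmaMin_nonneg (A : Matrix m n ℝ) : 0 ≤ sigmaMin A :=
  Real.iInf_nonneg fun _ => norm_nonneg _

theorem sigmaMin_mul_norm_le (A : Matrix m n ℝ) (x : EuclideanSpace ℝ n) :
    sigmaMin A * ‖x‖ ≤ ‖Matrix.toEuclideanLin A x‖ := by
  rcases eq_or_ne x 0 with rfl | hx
  · simp
  have hx' : 0 < ‖x‖ := norm_pos_iff.2 hx
  have hy : ‖x‖⁻¹ • x ∈ Metric.sphere (0 : EuclideanSpace ℝ n) 1 := by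
    simp [norm_smul, hx'.ne']
  have h : sigmaMin A ≤ ‖Matrix.toEuclideanLin A (‖x‖⁻¹ • x)‖ :=
    ciInf_le (f := fun x : Metric.sphere (0 : EuclideanSpace ℝ n) 1 =>
      ‖Matrix.toEuclideanLin A x.1‖) ⟨0, by rintro _ ⟨y, rfl⟩; exact norm_nonneg _⟩ ⟨_, hy⟩
  rw [map_smul, norm_smul, norm_inv, norm_norm] at h
  calc _ ≤ ‖x‖⁻¹ * ‖Matrix.toEuclideanLin A x‖ * ‖x‖ := by gcongr
    _ = _ := by field_simp

/-- Nonemptiness matters: with no columns the unit sphere is empty and the real infimum defaults to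
0. -/
theorem le_sigmaMin [Nonempty n] {A : Matrix m n ℝ} {c : ℝ}
    (h : ∀ x, c * ‖x‖ ≤ ‖Matrix.toEuclideanLin A x‖) : c ≤ sigmaMin A := by
  obtain ⟨j⟩ := ‹Nonempty n›
  have : Nonempty (Metric.sphere (0 : EuclideanSpace ℝ n) 1) :=
    ⟨⟨EuclideanSpace.single j 1, by simp⟩⟩
  refine le_ciInf fun x => ?_
  have hx : ‖x.1‖ = 1 := by simp
  simpa [hx] using h x.1

theorem sigmaMin_le_norm [Nonempty n] (A : Matrix m n ℝ) : sigmaMin A ≤ ‖A‖ := by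
  obtain ⟨j⟩ := ‹Nonempty n›
  have h1 := sigmaMin_mul_norm_le A (EuclideanSpace.single j 1)
  have h2 := norm_toEuclideanLin_le A (EuclideanSpace.single j 1)
  simp only [PiLp.norm_single, norm_one, mul_one] at h1 h2
  exact h1.trans h2

theorem cond_le_of_bounds [Nonempty n] {A : Matrix m n ℝ} {a b : ℝ} (hb : 0 < b) (ha : ‖A‖ ≤ a)
    (h : ∀ x, b * ‖x‖ ≤ ‖Matrix.toEuclideanLin A x‖) : cond A ≤ ENNReal.ofReal (a / b) := by
  have hs := le_sigmaMin h
  rw [cond, if_neg (hb.trans_le hs).ne']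
  exact ENNReal.ofReal_le_ofReal
    (div_le_div₀ ((norm_nonneg _).trans ha) ha hb hs)

end Norms

/-! ### Column selection as composition with an isometric embedding. -/

section Columns

variable {m n l : Type*} [Fintype n] [DecidableEq n] [Fintype l]

/-- The vector supported on the range of an injection. -/
def extendVec (f : l → n) (x : EuclideanSpace ℝ l) : EuclideanSpace ℝ n :=
  ∑ j, x j • EuclideanSpace.single (f j) (1 : ℝ)

theorem norm_extendVec {f : l → n} (hf : Function.Injective f) (x : EuclideanSpace ℝ l) :
    ‖extendVec f x‖ = ‖x‖ := by
  have ho : Orthonormal ℝ fun j => EuclideanSpace.single (f j) (1 : ℝ) :=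
    (EuclideanSpace.orthonormal_single (𝕜 := ℝ) (ι := n)).comp f hf
  rw [← sq_eq_sq₀ (norm_nonneg _) (norm_nonneg _), ← real_inner_self_eq_norm_sq, extendVec,
    ho.inner_sum, EuclideanSpace.real_norm_sq_eq]
  simp [sq]

theorem toEuclideanLin_submatrix [DecidableEq l] (A : Matrix m n ℝ) (f : l → n)
    (x : EuclideanSpace ℝ l) :
    Matrix.toEuclideanLin (A.submatrix id f) x = Matrix.toEuclideanLin A (extendVec f x) := by
  ext i
  rw [extendVec, map_sum]
  simp only [map_smul]
  simp [Matrix.toLpLin_apply, Matrix.mulVec, dotProduct, mul_comm]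

end Columns

/-! ### Near orthonormality from the Cholesky residual and the residual -/

section NearOrthonormal

variable {m n : Type*} [Fintype m] [Fintype n] [DecidableEq m] [DecidableEq n]

/-- Both errors are small relative to `‖Xz‖`, because `σ‖z‖ ≤ ‖Xz‖`. So `R` is injective, hence
onto, and with `w = Rz` one compares `‖Qw‖ = ‖Xz + Dz‖` with `‖Xz‖`, and `‖Xz‖` with `‖Rz‖ = ‖w‖`.
The factor `4/3` is `1 / (1 - η)` at `η = 1/4`. -/
theorem abs_norm_toEuclideanLin_sub_norm_le {X Q D : Matrix m n ℝ} {R E : Matrix n n ℝ}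
    {σ η θ : ℝ} (hσ : 0 < σ) (hX : ∀ z, σ * ‖z‖ ≤ ‖Matrix.toEuclideanLin X z‖)
    (hE : R.transpose * R = X.transpose * X + E) (hEn : ‖E‖ ≤ η * σ ^ 2) (hη : η ≤ 1 / 4)
    (hD : Q * R = X + D) (hDn : ‖D‖ ≤ θ * σ) (w : EuclideanSpace ℝ n) :
    |‖Matrix.toEuclideanLin Q w‖ - ‖w‖| ≤ 4 / 3 * (θ + η) * ‖w‖ := by
  have hη0 : 0 ≤ η := by
    by_contra! h
    have := mul_neg_of_neg_of_pos h (pow_pos hσ 2)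
    linarith [norm_nonneg E]
  have hθ0 : 0 ≤ θ := by
    by_contra! h
    have := mul_neg_of_neg_of_pos h hσ
    linarith [norm_nonneg D]
  have hR : ∀ z, |‖Matrix.toEuclideanLin R z‖ ^ 2 - ‖Matrix.toEuclideanLin X z‖ ^ 2| ≤
      η * ‖Matrix.toEuclideanLin X z‖ ^ 2 := by
    intro z
    rw [norm_sq_toEuclideanLin R, norm_sq_toEuclideanLin X, hE, map_add, LinearMap.add_apply,
      inner_add_right, add_sub_cancel_left, ← norm_sq_toEuclideanLin X]
    calc _ ≤ ‖z‖ * ‖Matrix.toEuclideanLin E z‖ := abs_real_inner_le_norm _ _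
      _ ≤ ‖z‖ * (η * σ ^ 2 * ‖z‖) := by
        gcongr
        exact (norm_toEuclideanLin_le E z).trans (by gcongr)
      _ = η * (σ * ‖z‖) ^ 2 := by ring
      _ ≤ _ := by gcongr; exact hX z
  have hinj : Function.Injective (Matrix.toEuclideanLin R) := by
    rw [injective_iff_map_eq_zero]
    intro z hz
    have h1 := hR z
    rw [hz, norm_zero] at h1
    have h2 := neg_abs_le ((0 : ℝ) ^ 2 - ‖Matrix.toEuclideanLin X z‖ ^ 2)
    have h3 : ‖Matrix.toEuclideanLin X z‖ ^ 2 ≤ 0 := by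
      nlinarith [sq_nonneg ‖Matrix.toEuclideanLin X z‖]
    have h4 : ‖Matrix.toEuclideanLin X z‖ = 0 :=
      pow_eq_zero_iff two_ne_zero |>.1 (le_antisymm h3 (sq_nonneg _))
    have h5 := hX z
    rw [h4] at h5
    exact norm_le_zero_iff.1 (nonpos_of_mul_nonpos_right h5 hσ)
  obtain ⟨z, rfl⟩ := LinearMap.injective_iff_surjective.1 hinj w
  rw [← toEuclideanLin_mul, hD, map_add, LinearMap.add_apply]
  set x := Matrix.toEuclideanLin X z
  set v := ‖Matrix.toEuclideanLin R z‖
  have hv : 0 ≤ v := norm_nonneg _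
  have hu : 0 ≤ ‖x‖ := norm_nonneg _
  -- The bound on squares is divided by `‖x‖ + v`; the case `‖x‖ = 0` is separate.
  have h1 : |‖x‖ - v| ≤ η * ‖x‖ := by
    rcases hu.eq_or_lt with h | h
    · have h2 := hR z
      rw [← h] at h2 ⊢
      have : v = 0 := by
        refine pow_eq_zero_iff two_ne_zero |>.1 (le_antisymm ?_ (sq_nonneg v))
        have h3 := (le_abs_self _).trans h2
        change v ^ 2 - 0 ^ 2 ≤ _ at h3
        linarith
      simp [this]
    · have h2 : |‖x‖ - v| * (‖x‖ + v) ≤ η * ‖x‖ * (‖x‖ + v) := by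
        have h3 : |‖x‖ - v| * (‖x‖ + v) = |v ^ 2 - ‖x‖ ^ 2| := by
          rw [abs_sub_comm (v ^ 2), sq_sub_sq, abs_mul, abs_of_nonneg (add_nonneg hu hv), mul_comm]
        rw [h3]
        refine (hR z).trans ?_
        have : 0 ≤ η * ‖x‖ * v := by positivity
        nlinarith
      exact le_of_mul_le_mul_right h2 (by linarith)
  have h2 : |‖x + Matrix.toEuclideanLin D z‖ - ‖x‖| ≤ θ * ‖x‖ := by
    refine (_root_.abs_norm_sub_norm_le _ _).trans ?_
    rw [add_sub_cancel_left]
    calc _ ≤ ‖D‖ * ‖z‖ := norm_toEuclideanLin_le D z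
      _ ≤ θ * σ * ‖z‖ := by gcongr
      _ = θ * (σ * ‖z‖) := by ring
      _ ≤ _ := by gcongr; exact hX z
  have h3 : ‖x‖ ≤ 4 / 3 * v := by
    have := le_abs_self (‖x‖ - v)
    nlinarith
  have h4 := _root_.abs_sub_le ‖x + Matrix.toEuclideanLin D z‖ ‖x‖ v
  have h5 : (θ + η) * ‖x‖ ≤ (θ + η) * (4 / 3 * v) := by gcongr
  linarith

/-- Take `q` to be the largest absolute entry of `Q`. Near isometry on a basis vector gives `q ≤ 1 +
4/3 (θ(1 + q) + η)`, and `θ, η ≤ 1/8` forces `q ≤ 8/5`. -/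
theorem abs_entry_le_two {X Q D : Matrix m n ℝ} {R E : Matrix n n ℝ} {σ η θ : ℝ} (hσ : 0 < σ)
    (hX : ∀ z, σ * ‖z‖ ≤ ‖Matrix.toEuclideanLin X z‖)
    (hE : R.transpose * R = X.transpose * X + E) (hEn : ‖E‖ ≤ η * σ ^ 2) (hη : η ≤ 1 / 8)
    (hD : Q * R = X + D) (hθ : θ ≤ 1 / 8)
    (hDn : ∀ q, 0 ≤ q → (∀ i j, |Q i j| ≤ q) → ‖D‖ ≤ θ * (1 + q) * σ) (i : m) (j : n) :
    |Q i j| ≤ 2 := by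
  have : Nonempty (m × n) := ⟨(i, j)⟩
  obtain ⟨⟨k, l⟩, hkl⟩ := Finite.exists_max fun x : m × n => |Q x.1 x.2|
  refine (hkl (i, j)).trans ?_
  simp only
  set q := |Q k l|
  have hq : 0 ≤ q := abs_nonneg _
  have h1 := abs_norm_toEuclideanLin_sub_norm_le hσ hX hE hEn (by linarith) hD
    (hDn q hq fun i j => hkl (i, j)) (EuclideanSpace.single l 1)
  have h2 := abs_entry_le_norm_column Q k l
  rw [PiLp.norm_single, norm_one, mul_one] at h1
  have h3 := (abs_le.1 h1).2
  have h4 : θ * (1 + q) ≤ 1 / 8 * (1 + q) := by gcongr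
  change q ≤ _ at h2
  linarith

end NearOrthonormal

/-! ### Backward errors of one iteration -/

/-- The three pieces mirror the algorithm: the projection onto earlier blocks, the inner sum of the
Cholesky or substitution recursion, and the pivot term. -/
theorem sum_eq_before_add {p s : ℕ} (k : Fin p) (b : Fin s) (f : Fin p × Fin s → ℝ)
    (h : ∀ y, k < y.1 → f y = 0) (h' : ∀ c, b < c → f (k, c) = 0) :
    ∑ y, f y = ∑ y ∈ before s k, f y + ∑ l ∈ Finset.Iio b, f (k, l) + f (k, b) := by
  have h1 : ∑ c, f (k, c) = ∑ l ∈ Finset.Iio b, f (k, l) + f (k, b) := by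
    rw [← Finset.sum_subset (Finset.subset_univ (Finset.Iic b)), ← Finset.Iio_insert,
      Finset.sum_insert (by simp), add_comm]
    intro c _ hc
    exact h' c (by simpa using hc)
  have h2 : ∑ y ∈ Finset.univ.filter (fun y : Fin p × Fin s => ¬ y.1 < k), f y =
      ∑ c, f (k, c) := by
    refine ((Finset.sum_map Finset.univ ⟨fun c => (k, c), Prod.mk_right_injective k⟩ f).symm.trans
      ?_).symm
    refine Finset.sum_subset (fun y hy => ?_) (fun y hy hy' => ?_)
    · obtain ⟨c, -, rfl⟩ := Finset.mem_map.1 hy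
      simp
    · refine h y (lt_of_le_of_ne (by simpa using hy) fun e => hy' ?_)
      exact Finset.mem_map.2 ⟨y.2, Finset.mem_univ _, Prod.ext e rfl⟩
  rw [← Finset.sum_filter_add_sum_filter_not Finset.univ (fun y : Fin p × Fin s => y.1 < k), h2, h1,
    add_assoc]
  rfl

theorem card_before_le {p s : ℕ} (k : Fin p) : (before s k).card ≤ p * s :=
  (Finset.card_le_univ _).trans (by simp)

theorem abs_sum_mul_le {ι : Type*} (t : Finset ι) (x y : ι → ℝ) :
    |∑ i ∈ t, x i * y i| ≤ ∑ i ∈ t, |x i| * |y i| :=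
  (Finset.abs_sum_le_sum_abs _ _).trans_eq (Finset.sum_congr rfl fun _ _ => abs_mul _ _)

theorem FlChol.diag_ne_zero {s : ℕ} {ε : ℝ} (hε : ε < 1) {A R : Matrix (Fin s) (Fin s) ℝ}
    (h : FlChol ε A R) (j : Fin s) : R j j ≠ 0 := by
  obtain ⟨t, -, ht, δ, hδ, h⟩ := h.2.2 j
  rw [h]
  have := (abs_le.1 hδ).1
  exact (mul_pos (Real.sqrt_pos.2 ht) (by linarith)).ne'

/-- Treats the division and the square root uniformly: multiplying back by the pivot recovers the
computed numerator or radicand. The factor 3 comes from the square root, where `(1 + δ)² - 1 = (2 +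
δ)δ`. -/
theorem FlChol.exists_pivot {s L : ℕ} {ε g : ℝ} (hg : ErrorBound ε L g)
    {A R : Matrix (Fin s) (Fin s) ℝ} (h : FlChol ε A R) {i j : Fin s} (hij : i ≤ j) :
    ∃ t, FlSubDot ε (A i j) (Finset.Iio i) (fun l => R l i) (fun l => R l j) t ∧
      |R i i * R i j - t| ≤ 3 * g * |t| := by
  have hε := hg.eps_nonneg
  have hεg := hg.eps_le
  have hgle := hg.le
  rcases hij.lt_or_eq with hlt | rfl
  · obtain ⟨t, ht, hR⟩ := h.2.1 i j hlt
    refine ⟨t, ht, ?_⟩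
    have h0 := h.diag_ne_zero (by linarith) i
    have h1 := mul_le_mul_of_nonneg_left hR.abs_sub_le (abs_nonneg (R i i))
    rw [← abs_mul, mul_sub, mul_div_cancel₀ _ h0, abs_div] at h1
    refine h1.trans ?_
    have : |R i i| ≠ 0 := abs_ne_zero.2 h0
    calc _ = ε * |t| := by field_simp
      _ ≤ _ := by gcongr; linarith
  · obtain ⟨t, ht, ht0, δ, hδ, hR⟩ := h.2.2 i
    refine ⟨t, ht, ?_⟩
    have h1 : R i i * R i i - t = (2 + δ) * δ * t := by
      rw [hR]
      linear_combination (1 + δ) ^ 2 * Real.mul_self_sqrt ht0.le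
    have h2 := abs_le.1 hδ
    rw [h1, abs_mul, abs_mul]
    refine mul_le_mul_of_nonneg_right (mul_le_mul ?_ (hδ.trans hεg) (abs_nonneg _) (by norm_num))
      (abs_nonneg _)
    rw [abs_le]
    constructor <;> linarith

section Step

variable {m p s L : ℕ} {ε g : ℝ} {X Q : Matrix (Fin m) (Fin p × Fin s) ℝ}
  {R : Matrix (Fin p × Fin s) (Fin p × Fin s) ℝ} {k : Fin p}

/-- Together with the zero blocks below the diagonal, this truncates the full sums to the terms the
algorithm evaluates. -/
theorem FlPIPStep.upper (h : FlPIPStep ε X Q R k) {b c : Fin s} (hbc : b < c) :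
    R (k, c) (k, b) = 0 := by
  obtain ⟨_, _, _, _, _, -, -, -, -, h, -⟩ := h
  exact h.1 c b hbc

theorem FlPIPStep.gram_sub_le (hg : ErrorBound ε L g) (hL : m + p * s + 2 ≤ L)
    (h : FlPIPStep ε X Q R k) (hR : ∀ l, k < l → block R l k = 0) (a b : Fin s) :
    |∑ y, R y (k, a) * R y (k, b) - ∑ i, X i (k, a) * X i (k, b)| ≤
      10 * g * (∑ i, |X i (k, a)| * |X i (k, b)| + ∑ y, |R y (k, a)| * |R y (k, b)|) := by
  -- The Cholesky recursion reads only the upper triangle, whereas the Gram error is symmetric.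
  wlog hab : a ≤ b generalizing a b
  · simpa only [mul_comm] using this b a (le_of_not_ge hab)
  have hzero : ∀ y : Fin p × Fin s, k < y.1 → R y (k, a) = 0 := fun y hy =>
    congrFun (congrFun (hR y.1 hy) y.2) a
  have hup : ∀ c, a < c → R (k, c) (k, a) = 0 := fun c hc => h.upper hc
  rw [sum_eq_before_add k a _ (fun y hy => by rw [hzero y hy, zero_mul])
      (fun c hc => by rw [hup c hc, zero_mul]),
    sum_eq_before_add k a (fun y => |R y (k, a)| * |R y (k, b)|)
      (fun y hy => by rw [hzero y hy, abs_zero, zero_mul])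
      (fun c hc => by rw [hup c hc, abs_zero, zero_mul])]
  obtain ⟨P, W, A, Z, V, -, hP, hW, hA, hC, -⟩ := h
  have hs : s ≤ p * s := Nat.le_mul_of_pos_left s (Fin.pos k)
  obtain ⟨t, ht, htR⟩ := hC.exists_pivot hg hab
  have e1 := (hP a b).abs_sub_le hg (by simp; omega)
  have e2 := (hW a b).abs_sub_le hg (by have := card_before_le (s := s) k; omega)
  have e3 := hg.sub_le (hA a b) e1 e2 (abs_sum_mul_le _ _ _) (abs_sum_mul_le _ _ _)
  have e4 := ht.abs_sub_le hg (by simp; omega)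
  have e5 := hg.recursion_le e3 ((abs_sub _ _).trans (add_le_add (abs_sum_mul_le _ _ _)
    (abs_sum_mul_le _ _ _))) e4 (abs_sum_mul_le _ _ _) htR
  refine e5.trans (mul_le_mul_of_nonneg_left ?_ (by linarith [hg.nonneg]))
  have : 0 ≤ |R (k, a) (k, a)| * |R (k, a) (k, b)| := by positivity
  simp only [block, blockCol, Matrix.transpose_apply]
  linarith

/-- A backward error of subtraction and substitution alone: it holds whatever the off-diagonal
blocks of `R` are, so their projection formula plays no role. -/
theorem FlPIPStep.residual_le (hg : ErrorBound ε L g) (hL : m + p * s + 2 ≤ L)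
    (h : FlPIPStep ε X Q R k) (hR : ∀ l, k < l → block R l k = 0) (i : Fin m) (b : Fin s) :
    |∑ y, Q i y * R y (k, b) - X i (k, b)| ≤
      10 * g * (|X i (k, b)| + ∑ y, |Q i y| * |R y (k, b)|) := by
  have hzero : ∀ y : Fin p × Fin s, k < y.1 → R y (k, b) = 0 := fun y hy =>
    congrFun (congrFun (hR y.1 hy) y.2) b
  have hup : ∀ c, b < c → R (k, c) (k, b) = 0 := fun c hc => h.upper hc
  rw [sum_eq_before_add k b _ (fun y hy => by rw [hzero y hy, mul_zero])
      (fun c hc => by rw [hup c hc, mul_zero]),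
    sum_eq_before_add k b (fun y => |Q i y| * |R y (k, b)|)
      (fun y hy => by rw [hzero y hy, abs_zero, mul_zero])
      (fun c hc => by rw [hup c hc, abs_zero, mul_zero])]
  obtain ⟨P, W, A, Z, V, -, -, -, -, hC, hZ, hV, hQ⟩ := h
  have hs : s ≤ p * s := Nat.le_mul_of_pos_left s (Fin.pos k)
  have hg0 := hg.nonneg
  obtain ⟨t, ht, htQ⟩ := hQ i b
  have e2 := (hZ i b).abs_sub_le hg (by have := card_before_le (s := s) k; omega)
  have e1 : |blockCol X k i b - blockCol X k i b| ≤ g * |blockCol X k i b| := by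
    simp only [sub_self, abs_zero]; positivity
  have e3 := hg.sub_le (hV i b) e1 e2 le_rfl (abs_sum_mul_le _ _ _)
  have e4 := ht.abs_sub_le hg (by simp; omega)
  have htR : |Q i (k, b) * R (k, b) (k, b) - t| ≤ 3 * g * |t| := by
    have h0 : R (k, b) (k, b) ≠ 0 :=
      hC.diag_ne_zero (by linarith [hg.eps_le, hg.le]) b
    have h1 := mul_le_mul_of_nonneg_left htQ.abs_sub_le (abs_nonneg (R (k, b) (k, b)))
    simp only [block, blockCol] at h1
    rw [← abs_mul, mul_sub, mul_div_cancel₀ _ h0, abs_div, mul_comm] at h1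
    refine h1.trans ?_
    have : |R (k, b) (k, b)| ≠ 0 := abs_ne_zero.2 h0
    calc _ = ε * |t| := by field_simp
      _ ≤ _ := by gcongr; linarith [hg.eps_le]
  have e5 := hg.recursion_le e3 ((abs_sub _ _).trans (add_le_add le_rfl
    (abs_sum_mul_le _ _ _))) e4 (abs_sum_mul_le _ _ _) htR
  refine e5.trans (mul_le_mul_of_nonneg_left ?_ (by linarith))
  have : 0 ≤ |Q i (k, b)| * |R (k, b) (k, b)| := by positivity
  simp only [block, blockCol]
  linarith

theorem FlPIPStep.projection_le (hg : ErrorBound ε L g) (hL : m + p * s + 2 ≤ L)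
    (h : FlPIPStep ε X Q R k) {y : Fin p × Fin s} (hy : y.1 < k) (b : Fin s) :
    |R y (k, b) - ∑ i, Q i y * X i (k, b)| ≤ g * ∑ i, |Q i y| * |X i (k, b)| := by
  obtain ⟨P, W, A, Z, V, h, -⟩ := h
  exact (h y.1 hy y.2 b).abs_sub_le hg (by simp; omega)

end Step

/-! ### Error analysis of BCGS-PIP -/

theorem sum_le_mul_of_card_le {ι : Type*} [Fintype ι] {f : ι → ℝ} {N c : ℝ}
    (hN : (Fintype.card ι : ℝ) ≤ N) (hc : 0 ≤ c) (h : ∀ i, f i ≤ c) : ∑ i, f i ≤ N * c := by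
  refine (Finset.sum_le_card_nsmul _ _ c fun i _ => h i).trans ?_
  rw [nsmul_eq_mul, Finset.card_univ]
  gcongr

/-- The entrywise error bounds satisfied by a run of BCGS-PIP. -/
structure PIPBounds {m p s : ℕ} (N ε : ℝ) (X Q : Matrix (Fin m) (Fin p × Fin s) ℝ)
    (R : Matrix (Fin p × Fin s) (Fin p × Fin s) ℝ) : Prop where
  eps_nonneg : 0 ≤ ε
  one_le : 1 ≤ N
  rows_le : (m : ℝ) ≤ N
  cols_le : ((p * s : ℕ) : ℝ) ≤ N
  upper : ∀ y x, x.1 < y.1 → R y x = 0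
  gram : ∀ k a b, |∑ y, R y (k, a) * R y (k, b) - ∑ i, X i (k, a) * X i (k, b)| ≤
    40 * N * ε * (N * ‖X‖ ^ 2 + ∑ y, |R y (k, a)| * |R y (k, b)|)
  projection : ∀ y x, y.1 < x.1 →
    |R y x - ∑ i, Q i y * X i x| ≤ 4 * N * ε * ∑ i, |Q i y| * |X i x|
  residual : ∀ i x q r, 0 ≤ q → 0 ≤ r → (∀ y, y.1 ≤ x.1 → ∀ j, |Q j y| ≤ q) →
    (∀ y z, |R y z| ≤ r) →
    |∑ y, Q i y * R y x - X i x| ≤ 40 * N * ε * (‖X‖ + N ^ 4 * q * r)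

theorem norm_blockCol_le {m p s : ℕ} (X : Matrix (Fin m) (Fin p × Fin s) ℝ) (k : Fin p) :
    ‖blockCol X k‖ ≤ ‖X‖ := by
  refine norm_le_of_forall_toEuclideanLin_le (norm_nonneg _) fun x => ?_
  have h := toEuclideanLin_submatrix X (fun b : Fin s => (k, b)) x
  rw [← norm_extendVec (Prod.mk_right_injective k) x]
  exact (congrArg norm h).trans_le (norm_toEuclideanLin_le X _)

/-- The length `m + p * s + 2` covers every inner product and recursion step of the algorithm. -/
theorem errorBound_of_dimensions {m p s : ℕ} {ε a N : ℝ} (hε : 0 ≤ ε) (ha : 0 ≤ a)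
    (hN : 1 + m + (p * s : ℕ) + a ≤ N) (hNε : 160 * N * ε ≤ 1) :
    ErrorBound ε (m + p * s + 2) (4 * N * ε) := by
  refine errorBound_of_mul_le hε (by omega) ?_ (by linarith)
  have hm0 : (0 : ℝ) ≤ m := Nat.cast_nonneg _
  have hn0 : (0 : ℝ) ≤ (p * s : ℕ) := Nat.cast_nonneg _
  push_cast at hN hn0 ⊢
  have : ((m : ℝ) + p * s + 2) * ε ≤ 2 * N * ε := by
    gcongr
    linarith
  linarith

theorem FlPIP.bounds {m p s : ℕ} {ε a N : ℝ} (hε : 0 ≤ ε) (ha : 0 ≤ a)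
    (hN : 1 + m + (p * s : ℕ) + a ≤ N) (hNε : 160 * N * ε ≤ 1)
    {intraOrtho : Matrix (Fin m) (Fin s) ℝ → Matrix (Fin m) (Fin s) ℝ × Matrix (Fin s) (Fin s) ℝ}
    {X Q : Matrix (Fin m) (Fin p × Fin s) ℝ} {R : Matrix (Fin p × Fin s) (Fin p × Fin s) ℝ}
    (h : FlPIP ε intraOrtho X Q R)
    (hintra : ∀ k : Fin p, k.val = 0 → IntraOrthoAccurate (a * ε) intraOrtho (blockCol X k)) :
    PIPBounds N ε X Q R := by
  have hm0 : (0 : ℝ) ≤ m := Nat.cast_nonneg _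
  have hn0 : (0 : ℝ) ≤ (p * s : ℕ) := Nat.cast_nonneg _
  have hN1 : 1 ≤ N := by linarith
  have hmN : (m : ℝ) ≤ N := by linarith
  have hnN : ((p * s : ℕ) : ℝ) ≤ N := by linarith
  have hg := errorBound_of_dimensions hε ha hN hNε
  have hX0 : 0 ≤ ‖X‖ := norm_nonneg X
  have hup : ∀ y x : Fin p × Fin s, x.1 < y.1 → R y x = 0 := fun y x hyx =>
    congrFun (congrFun (h.1 y.1 x.1 hyx) y.2) x.2
  have haN : a ≤ N := by linarith
  refine ⟨hε, hN1, hmN, hnN, hup, ?_, ?_, ?_⟩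
  · intro k b c
    rcases Nat.eq_zero_or_pos k.val with hk | hk
    · obtain ⟨⟨E, hE, hEn⟩, -⟩ := hintra k hk
      have hQR := h.2.1 k hk
      rw [← hQR] at hE
      have hsum : ∀ f : Fin p × Fin s → ℝ, (∀ y, k < y.1 → f y = 0) →
          ∑ y, f y = ∑ l, f (k, l) := by
        intro f hf
        rw [Fintype.sum_prod_type]
        refine Finset.sum_eq_single k (fun l _ hl => ?_) (by simp)
        refine Finset.sum_eq_zero fun c _ => hf _ (lt_of_le_of_ne ?_ hl.symm)
        rw [Fin.le_def]
        omega
      rw [hsum _ fun y hy => by rw [hup y (k, b) hy, zero_mul]]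
      have he := congrFun (congrFun hE b) c
      simp only [Matrix.add_apply, Matrix.mul_apply, Matrix.transpose_apply, block, blockCol] at he
      rw [he, add_sub_cancel_left]
      have h1 := norm_blockCol_le X k
      calc |E b c| ≤ ‖E‖ := abs_entry_le_norm E b c
        _ ≤ a * ε * ‖blockCol X k‖ ^ 2 := hEn
        _ ≤ N * ε * ‖X‖ ^ 2 := by gcongr
        _ ≤ 40 * N * ε * (N * ‖X‖ ^ 2) := by
          have : 0 ≤ N * ε * ‖X‖ ^ 2 := by positivity
          nlinarith
        _ ≤ _ := by
          gcongr
          exact le_add_of_nonneg_right (Finset.sum_nonneg fun _ _ => by positivity)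
    · refine ((h.2.2 k hk).gram_sub_le hg le_rfl (fun l hl => h.1 l k hl) b c).trans ?_
      have h1 : ∑ i, |X i (k, b)| * |X i (k, c)| ≤ N * ‖X‖ ^ 2 := by
        refine sum_le_mul_of_card_le (by simpa using hmN) (by positivity) fun i => ?_
        rw [sq]
        gcongr <;> exact abs_entry_le_norm X _ _
      calc _ = 40 * N * ε * (∑ i, |X i (k, b)| * |X i (k, c)| +
            ∑ y, |R y (k, b)| * |R y (k, c)|) := by ring
        _ ≤ _ := by gcongr
  · rintro y ⟨k, b⟩ hy
    have hk : 0 < k.val := lt_of_le_of_lt (Nat.zero_le _) (Fin.lt_def.1 hy)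
    exact (h.2.2 k hk).projection_le hg le_rfl hy b
  · rintro i ⟨k, b⟩ q r hq hr hQ hRr
    simp only at hQ ⊢
    rcases Nat.eq_zero_or_pos k.val with hk | hk
    · obtain ⟨-, ⟨D, hD, hDn⟩⟩ := hintra k hk
      have hQR := h.2.1 k hk
      rw [← hQR] at hD hDn
      have hsum : ∑ y, Q i y * R y (k, b) = ∑ l, Q i (k, l) * R (k, l) (k, b) := by
        rw [Fintype.sum_prod_type]
        refine Finset.sum_eq_single k (fun l _ hl => ?_) (by simp)
        refine Finset.sum_eq_zero fun c _ => ?_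
        rw [hup (l, c) (k, b) (lt_of_le_of_ne (by rw [Fin.le_def]; simp [hk]) hl.symm), mul_zero]
      have he := congrFun (congrFun hD i) b
      simp only [Matrix.add_apply, Matrix.mul_apply, block, blockCol] at he
      rw [hsum, he, add_sub_cancel_left]
      have hsN : (s : ℝ) ≤ N := by
        refine le_trans ?_ hnN
        exact_mod_cast Nat.le_mul_of_pos_left s (Fin.pos k)
      have h1 := norm_blockCol_le X k
      -- For the first block only a normwise residual is assumed. Converting entry bounds for `Q`
      -- and `R` costs `N²` each, hence the `N ^ 4` in `PIPBounds.residual`.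
      have h2 : ‖blockCol Q k‖ ≤ N * N * q := by
        refine (norm_le_of_forall_abs_entry_le (c := q) fun j c => hQ (k, c) le_rfl j).trans ?_
        simp only [Fintype.card_fin]
        gcongr
      have h3 : ‖block R k k‖ ≤ N * N * r := by
        refine (norm_le_of_forall_abs_entry_le (c := r) fun j c => hRr _ _).trans ?_
        simp only [Fintype.card_fin]
        gcongr
      calc |D i b| ≤ ‖D‖ := abs_entry_le_norm D i b
        _ ≤ a * ε * (‖blockCol X k‖ + ‖blockCol Q k‖ * ‖block R k k‖) := hDn
        _ ≤ N * ε * (‖X‖ + (N * N * q) * (N * N * r)) := by gcongr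
        _ = 1 * (N * ε * (‖X‖ + N ^ 4 * q * r)) := by ring
        _ ≤ 40 * (N * ε * (‖X‖ + N ^ 4 * q * r)) := by gcongr; norm_num
        _ = _ := by ring
    · refine ((h.2.2 k hk).residual_le hg le_rfl (fun l hl => h.1 l k hl) i b).trans ?_
      have h1 : ∑ y, |Q i y| * |R y (k, b)| ≤ N * (q * r) := by
        refine sum_le_mul_of_card_le (by simpa using hnN) (by positivity) fun y => ?_
        rcases le_or_gt y.1 k with hy | hy
        · exact mul_le_mul (hQ y hy i) (hRr _ _) (abs_nonneg _) hq
        · rw [hup y (k, b) hy, abs_zero, mul_zero]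
          positivity
      have h2 : N * (q * r) ≤ N ^ 4 * (q * r) := by
        gcongr
        exact le_self_pow₀ hN1 (by norm_num)
      calc _ = 40 * N * ε * (|X i (k, b)| + ∑ y, |Q i y| * |R y (k, b)|) := by ring
        _ ≤ _ := by
          gcongr
          · exact abs_entry_le_norm X _ _
          · linarith

/-! ### Breaking the circular dependence on the size of the computed basis. -/

namespace PIPBounds

variable {m p s : ℕ} {N ε : ℝ} {X Q : Matrix (Fin m) (Fin p × Fin s) ℝ}
  {R : Matrix (Fin p × Fin s) (Fin p × Fin s) ℝ}

/-- A diagonal Gram entry is the squared norm of a column of `R`, and its error is at most a quarter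
of that square plus a multiple of `‖X‖²`, so it can be absorbed. Nothing about `Q` enters, which
lets the induction start. -/
theorem abs_factor_le (h : PIPBounds N ε X Q R) (hNε : 160 * N * ε ≤ 1) (y x : Fin p × Fin s) :
    |R y x| ≤ 2 * N * ‖X‖ := by
  have hN := h.one_le
  have hX := norm_nonneg X
  have h1 := (abs_le.1 (h.gram x.1 x.2 x.2)).2
  have h2 : ∑ i, X i x * X i x ≤ N * ‖X‖ ^ 2 := by
    refine sum_le_mul_of_card_le (by simpa using h.rows_le) (by positivity) fun i => ?_
    rw [← sq, ← sq_abs]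
    gcongr
    exact abs_entry_le_norm X i x
  simp only [abs_mul_abs_self, Prod.mk.eta] at h1
  have h3 : R y x * R y x ≤ ∑ y, R y x * R y x :=
    Finset.single_le_sum (f := fun y => R y x * R y x) (fun _ _ => mul_self_nonneg _)
      (Finset.mem_univ y)
  set S := ∑ y, R y x * R y x
  have hS : 0 ≤ S := (mul_self_nonneg _).trans h3
  have h4 : 40 * N * ε * (N * ‖X‖ ^ 2 + S) ≤ 1 / 4 * (N * ‖X‖ ^ 2 + S) := by
    gcongr
    linarith
  refine abs_le_of_sq_le_sq ?_ (by positivity)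
  have h5 : N * ‖X‖ ^ 2 ≤ N * (N * ‖X‖ ^ 2) := le_mul_of_one_le_left (by positivity) hN
  have h6 : 0 ≤ N * ‖X‖ ^ 2 := by positivity
  nlinarith

theorem residual_entry_le (h : PIPBounds N ε X Q R) (hNε : 160 * N * ε ≤ 1) {q : ℝ} (hq : 0 ≤ q)
    (x : Fin p × Fin s) (hQ : ∀ y, y.1 ≤ x.1 → ∀ j, |Q j y| ≤ q) (i : Fin m) :
    |∑ y, Q i y * R y x - X i x| ≤ 80 * N ^ 6 * ε * ‖X‖ * (1 + q) := by
  have hN := h.one_le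
  have hε := h.eps_nonneg
  have hX := norm_nonneg X
  refine (h.residual i x q (2 * N * ‖X‖) hq (by positivity) hQ
    (h.abs_factor_le hNε)).trans ?_
  have h1 : (1 : ℝ) ≤ N ^ 5 := one_le_pow₀ hN
  calc _ = 40 * N * ε * ‖X‖ * (1 + 2 * N ^ 5 * q) := by ring
    _ ≤ 40 * N * ε * ‖X‖ * (2 * N ^ 5 * (1 + q)) := by
      gcongr
      linarith
    _ = _ := by ring

/-- Within a diagonal block this is the Cholesky backward error, free of `Q`. For `x` in an earlier
block than `x'`, replace `R y x'` by `Qᵀ X` and then `QR` by `X`; both steps involve only blocks of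
`Q` before that of `x'`. The strict inequality in `hQ` is what the induction needs. -/
theorem gram_entry_le (h : PIPBounds N ε X Q R) (hNε : 160 * N * ε ≤ 1) (x x' : Fin p × Fin s)
    (hQ : ∀ y, y.1 < max x.1 x'.1 → ∀ j, |Q j y| ≤ 2) :
    |∑ y, R y x * R y x' - ∑ i, X i x * X i x'| ≤ 300 * N ^ 7 * ε * ‖X‖ ^ 2 := by
  have hN := h.one_le
  have hε := h.eps_nonneg
  have hX := norm_nonneg X
  have hR := h.abs_factor_le hNε
  have h47 : N ^ 4 ≤ N ^ 7 := pow_le_pow_right₀ hN (by norm_num)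
  wlog hx : x.1 ≤ x'.1 generalizing x x'
  · simpa only [mul_comm] using this x' x (by rwa [max_comm]) (le_of_not_ge hx)
  rcases hx.lt_or_eq with hlt | heq
  · rw [max_eq_right hx] at hQ
    have e1 : ∑ y, R y x * R y x' - ∑ i, X i x * X i x' =
        ∑ y, R y x * (R y x' - ∑ i, Q i y * X i x') +
          ∑ i, (∑ y, Q i y * R y x - X i x) * X i x' := by
      simp only [mul_sub, sub_mul, Finset.sum_sub_distrib, Finset.mul_sum, Finset.sum_mul]
      rw [Finset.sum_comm]
      have : ∀ i y, R y x * (Q i y * X i x') = Q i y * R y x * X i x' := fun i y => by ring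
      simp only [this]
      ring
    have h1 : |∑ y, R y x * (R y x' - ∑ i, Q i y * X i x')| ≤
        N * (2 * N * ‖X‖ * (4 * N * ε * (N * (2 * ‖X‖)))) := by
      refine (Finset.abs_sum_le_sum_abs _ _).trans
        (sum_le_mul_of_card_le (by simpa using h.cols_le) (by positivity) fun y => ?_)
      rcases lt_or_ge x.1 y.1 with hy | hy
      · rw [h.upper y x hy, zero_mul, abs_zero]
        positivity
      · rw [abs_mul]
        have h2 : ∑ i, |Q i y| * |X i x'| ≤ N * (2 * ‖X‖) :=
          sum_le_mul_of_card_le (by simpa using h.rows_le) (by positivity) fun i =>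
            mul_le_mul (hQ y (hy.trans_lt hlt) i) (abs_entry_le_norm X i x') (abs_nonneg _)
              (by norm_num)
        refine mul_le_mul (hR y x) ((h.projection y x' (hy.trans_lt hlt)).trans ?_)
          (abs_nonneg _) (by positivity)
        gcongr
    have h2 : |∑ i, (∑ y, Q i y * R y x - X i x) * X i x'| ≤
        N * (80 * N ^ 6 * ε * ‖X‖ * (1 + 2) * ‖X‖) := by
      refine (Finset.abs_sum_le_sum_abs _ _).trans
        (sum_le_mul_of_card_le (by simpa using h.rows_le) (by positivity) fun i => ?_)
      rw [abs_mul]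
      exact mul_le_mul (h.residual_entry_le hNε (by norm_num) x
        (fun y hy => hQ y (hy.trans_lt hlt)) i) (abs_entry_le_norm X i x') (abs_nonneg _)
        (by positivity)
    rw [e1]
    refine (abs_add_le _ _).trans ?_
    have h3 : N ^ 4 * (ε * ‖X‖ ^ 2) ≤ N ^ 7 * (ε * ‖X‖ ^ 2) := by gcongr
    have h4 : 0 ≤ N ^ 7 * (ε * ‖X‖ ^ 2) := by positivity
    linarith
  · obtain ⟨k, b⟩ := x
    obtain ⟨k', c⟩ := x'
    obtain rfl : k = k' := heq
    refine (h.gram k b c).trans ?_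
    have h1 : ∑ y, |R y (k, b)| * |R y (k, c)| ≤ N * ((2 * N * ‖X‖) * (2 * N * ‖X‖)) :=
      sum_le_mul_of_card_le (by simpa using h.cols_le) (by positivity) fun y =>
        mul_le_mul (hR _ _) (hR _ _) (abs_nonneg _) (by positivity)
    have h13 : N ≤ N ^ 3 := le_self_pow₀ hN (by norm_num)
    calc _ ≤ 40 * N * ε * (N ^ 3 * ‖X‖ ^ 2 + N * ((2 * N * ‖X‖) * (2 * N * ‖X‖))) := by gcongr
      _ = 200 * (N ^ 4 * ε * ‖X‖ ^ 2) := by ring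
      _ ≤ 300 * (N ^ 7 * ε * ‖X‖ ^ 2) := by gcongr; norm_num
      _ = _ := by ring

/-- Strong induction on the block index, applying `abs_entry_le_two` to the leading blocks. The
constants are `2400 = 8 · 300` and `640 = 8 · 80`, making `η` and `θ` at most `1/8`. -/
theorem abs_basis_le_two (h : PIPBounds N ε X Q R) (hNε : 160 * N * ε ≤ 1) {σ : ℝ} (hσ : 0 < σ)
    (hX : ∀ z, σ * ‖z‖ ≤ ‖Matrix.toEuclideanLin X z‖)
    (hE : 2400 * N ^ 9 * ε * ‖X‖ ^ 2 ≤ σ ^ 2) (hD : 640 * N ^ 8 * ε * ‖X‖ ≤ σ)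
    (i : Fin m) (x : Fin p × Fin s) : |Q i x| ≤ 2 := by
  have hN := h.one_le
  have hε := h.eps_nonneg
  have hX0 := norm_nonneg X
  obtain ⟨k, hk⟩ : ∃ k, k = x.1 := ⟨_, rfl⟩
  induction k using WellFoundedLT.induction generalizing x i with
  | ind k ih =>
    have hprev : ∀ y : Fin p × Fin s, y.1 < k → ∀ j, |Q j y| ≤ 2 := fun y hy j =>
      ih y.1 hy j y rfl
    let J := {y : Fin p × Fin s // y.1 ≤ k}
    let v : J → Fin p × Fin s := Subtype.val
    have hcard : (Fintype.card J : ℝ) ≤ N := by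
      refine le_trans ?_ h.cols_le
      exact_mod_cast (Fintype.card_subtype_le _).trans (by simp)
    -- Block triangularity: truncating to the leading blocks commutes with forming `QR` and `RᵀR`.
    have hsum : ∀ (x : J) (f : Fin p × Fin s → ℝ),
        ∑ y : J, f (v y) * R (v y) (v x) = ∑ y, f y * R y (v x) := by
      intro x f
      rw [← Finset.sum_subtype (Finset.univ.filter fun y : Fin p × Fin s => y.1 ≤ k) (by simp)
        fun y => f y * R y (v x)]
      refine Finset.sum_subset (Finset.filter_subset _ _) fun y _ hy => ?_
      rw [h.upper y (v x) (x.2.trans_lt (by simpa using hy)), mul_zero]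
    set XJ := X.submatrix id v
    set QJ := Q.submatrix id v
    set RJ := R.submatrix v v
    have hXJ : ∀ z, σ * ‖z‖ ≤ ‖Matrix.toEuclideanLin XJ z‖ := by
      intro z
      rw [toEuclideanLin_submatrix, ← norm_extendVec Subtype.val_injective z]
      exact hX _
    have hEJ : ‖RJ.transpose * RJ - XJ.transpose * XJ‖ ≤
        300 * N ^ 9 * ε * ‖X‖ ^ 2 / σ ^ 2 * σ ^ 2 := by
      rw [div_mul_cancel₀ _ (by positivity)]
      refine (norm_le_of_forall_abs_entry_le (c := 300 * N ^ 7 * ε * ‖X‖ ^ 2) fun x x' => ?_).trans ?_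
      · have h1 := h.gram_entry_le hNε (v x) (v x') fun y hy =>
          hprev y (hy.trans_le (max_le x.2 x'.2))
        rw [← hsum x' fun y => R y (v x)] at h1
        simpa [Matrix.mul_apply, XJ, RJ] using h1
      · calc _ ≤ N * N * (300 * N ^ 7 * ε * ‖X‖ ^ 2) := by gcongr
          _ = _ := by ring
    refine abs_entry_le_two (X := XJ) (Q := QJ) (R := RJ) (D := QJ * RJ - XJ)
      (E := RJ.transpose * RJ - XJ.transpose * XJ) (θ := 80 * N ^ 8 * ε * ‖X‖ / σ) hσ hXJ (by abel)
      hEJ ?_ (by abel) ?_ ?_ i ⟨x, hk.ge⟩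
    · rw [div_le_iff₀ (by positivity)]
      linarith
    · rw [div_le_iff₀ hσ]
      linarith
    · intro q hq hQ
      refine (norm_le_of_forall_abs_entry_le (c := 80 * N ^ 6 * ε * ‖X‖ * (1 + q)) fun j x => ?_).trans
        ?_
      · have h1 := h.residual_entry_le hNε hq (v x) (fun y hy j => hQ j ⟨y, hy.trans x.2⟩) j
        rw [← hsum x fun y => Q j y] at h1
        simpa [Matrix.mul_apply, XJ, RJ, QJ] using h1
      · rw [Fintype.card_fin]
        have := h.rows_le
        calc _ ≤ N * N * (80 * N ^ 6 * ε * ‖X‖ * (1 + q)) := by gcongr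
          _ = _ := by field_simp

end PIPBounds

/-- A run of BCGS-PIP on a matrix with `2400 N⁹ ε κ² ≤ 1`. -/
theorem FlPIP.error_bounds {m p s : ℕ} (hp : 0 < p) (hs : 0 < s) {ε a N : ℝ} (hε : 0 ≤ ε)
    (ha : 0 ≤ a) (hN : 1 + m + (p * s : ℕ) + a ≤ N)
    {intraOrtho : Matrix (Fin m) (Fin s) ℝ → Matrix (Fin m) (Fin s) ℝ × Matrix (Fin s) (Fin s) ℝ}
    {X Q : Matrix (Fin m) (Fin p × Fin s) ℝ} {R : Matrix (Fin p × Fin s) (Fin p × Fin s) ℝ}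
    (h : FlPIP ε intraOrtho X Q R)
    (hintra : ∀ k : Fin p, k.val = 0 → IntraOrthoAccurate (a * ε) intraOrtho (blockCol X k))
    (hσ : 0 < sigmaMin X) (hκ : 2400 * N ^ 9 * ε * ‖X‖ ^ 2 ≤ sigmaMin X ^ 2) :
    (∀ y x, |R y x| ≤ 2 * N * ‖X‖) ∧
    ‖R.transpose * R - X.transpose * X‖ ≤ 300 * N ^ 9 * ε * ‖X‖ ^ 2 ∧
    ‖Q * R - X‖ ≤ 240 * N ^ 8 * ε * ‖X‖ ∧
    ∀ w, |‖Matrix.toEuclideanLin Q w‖ - ‖w‖| ≤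
      720 * N ^ 9 * ε * (‖X‖ / sigmaMin X) ^ 2 * ‖w‖ := by
  have : Nonempty (Fin p × Fin s) := ⟨(⟨0, hp⟩, ⟨0, hs⟩)⟩
  have hn0 : (0 : ℝ) ≤ (p * s : ℕ) := Nat.cast_nonneg _
  have hN1 : 1 ≤ N := by linarith [(Nat.cast_nonneg m : (0 : ℝ) ≤ m)]
  have hσX := sigmaMin_le_norm X
  set σ := sigmaMin X
  have hX0 : 0 < ‖X‖ := hσ.trans_le hσX
  have hNε9 : 2400 * N ^ 9 * ε ≤ 1 := by
    have h1 : 2400 * N ^ 9 * ε * ‖X‖ ^ 2 ≤ 1 * ‖X‖ ^ 2 := by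
      rw [one_mul]
      exact hκ.trans (by gcongr)
    exact le_of_mul_le_mul_right h1 (by positivity)
  have hNε : 160 * N * ε ≤ 1 := by
    refine le_trans ?_ hNε9
    gcongr
    · norm_num
    · exact le_self_pow₀ hN1 (by norm_num)
  -- Multiply by `‖X‖` and use `σ² ≤ σ‖X‖`: the quadratic condition implies the linear one.
  have hD : 640 * N ^ 8 * ε * ‖X‖ ≤ σ := by
    have h1 : 640 * N ^ 8 * ε * ‖X‖ * ‖X‖ ≤ σ * ‖X‖ := by
      calc _ = 640 * N ^ 8 * (ε * ‖X‖ ^ 2) := by ring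
        _ ≤ 2400 * N ^ 9 * (ε * ‖X‖ ^ 2) := by
          gcongr
          · norm_num
          · norm_num
        _ ≤ σ ^ 2 := by linarith
        _ = σ * σ := sq σ
        _ ≤ _ := by gcongr
    exact le_of_mul_le_mul_right h1 hX0
  have hb := h.bounds hε ha hN hNε hintra
  have hQ := hb.abs_basis_le_two hNε hσ (sigmaMin_mul_norm_le X) hκ hD
  have hEn : ‖R.transpose * R - X.transpose * X‖ ≤ 300 * N ^ 9 * ε * ‖X‖ ^ 2 := by
    refine (norm_le_of_forall_abs_entry_le (c := 300 * N ^ 7 * ε * ‖X‖ ^ 2) fun x x' => ?_).trans ?_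
    · exact hb.gram_entry_le hNε x x' fun y _ j => hQ j y
    · have h1 := hb.cols_le
      calc _ ≤ N * N * (300 * N ^ 7 * ε * ‖X‖ ^ 2) := by
            gcongr <;> simpa using h1
        _ = _ := by ring
  have hDn : ‖Q * R - X‖ ≤ 240 * N ^ 8 * ε * ‖X‖ := by
    refine (norm_le_of_forall_abs_entry_le (c := 80 * N ^ 6 * ε * ‖X‖ * (1 + 2)) fun i x => ?_).trans
      ?_
    · exact hb.residual_entry_le hNε (by norm_num) x (fun y _ j => hQ j y) i
    · have h1 := hb.cols_le
      have h2 := hb.rows_le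
      calc _ ≤ N * N * (80 * N ^ 6 * ε * ‖X‖ * (1 + 2)) := by
            gcongr
            · simpa using h2
            · simpa using h1
        _ = _ := by ring
  refine ⟨hb.abs_factor_le hNε, hEn, hDn, fun w => ?_⟩
  have h1 := abs_norm_toEuclideanLin_sub_norm_le (X := X) (Q := Q) (R := R) (D := Q * R - X)
    (E := R.transpose * R - X.transpose * X) (η := 300 * N ^ 9 * ε * ‖X‖ ^ 2 / σ ^ 2)
    (θ := 240 * N ^ 8 * ε * ‖X‖ / σ) hσ (sigmaMin_mul_norm_le X) (by abel)
    (by rwa [div_mul_cancel₀ _ (by positivity)])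
    (by rw [div_le_iff₀ (by positivity)]; linarith [sq_nonneg σ]) (by abel)
    (by rwa [div_mul_cancel₀ _ (by positivity)]) w
  refine h1.trans (mul_le_mul_of_nonneg_right ?_ (norm_nonneg w))
  -- The residual contributes only `κ`, raised here to `κ²`; then `720 = 4/3 (240 + 300)`.
  have h2 : 1 ≤ ‖X‖ / σ := (one_le_div hσ).2 hσX
  have h3 : N ^ 8 * ε * (‖X‖ / σ) ≤ N ^ 9 * ε * (‖X‖ / σ) ^ 2 := by
    gcongr
    · norm_num
    · exact le_self_pow₀ h2 (by norm_num)
  have e1 : 240 * N ^ 8 * ε * ‖X‖ / σ = 240 * (N ^ 8 * ε * (‖X‖ / σ)) := by ring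
  have e2 : 300 * N ^ 9 * ε * ‖X‖ ^ 2 / σ ^ 2 = 300 * (N ^ 9 * ε * (‖X‖ / σ) ^ 2) := by
    rw [div_pow]; ring
  rw [e1, e2]
  linarith

/-! ### Error analysis of BCGS-PIP+ -/

theorem toEuclideanLin_blockCol {m p s : ℕ} (X : Matrix (Fin m) (Fin p × Fin s) ℝ) (k : Fin p)
    (x : EuclideanSpace ℝ (Fin s)) : Matrix.toEuclideanLin (blockCol X k) x =
      Matrix.toEuclideanLin X (extendVec (fun b => (k, b)) x) :=
  toEuclideanLin_submatrix X (fun b : Fin s => (k, b)) x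

theorem cond_blockCol_le {m p s : ℕ} (hs : 0 < s) {X : Matrix (Fin m) (Fin p × Fin s) ℝ}
    {a b : ℝ} (hb : 0 < b) (ha : ‖X‖ ≤ a) (h : ∀ x, b * ‖x‖ ≤ ‖Matrix.toEuclideanLin X x‖)
    (k : Fin p) : cond (blockCol X k) ≤ ENNReal.ofReal (a / b) := by
  have : Nonempty (Fin s) := ⟨⟨0, hs⟩⟩
  refine cond_le_of_bounds hb ((norm_blockCol_le X k).trans ha) fun x => ?_
  rw [toEuclideanLin_blockCol, ← norm_extendVec (Prod.mk_right_injective k) x]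
  exact h _

theorem norm_mul_le_of_le {l m n : Type*} [Fintype l] [Fintype m] [Fintype n] [DecidableEq l]
    [DecidableEq m] [DecidableEq n] {A : Matrix l m ℝ} {B : Matrix m n ℝ} {a b : ℝ}
    (hA : ‖A‖ ≤ a) (hB : ‖B‖ ≤ b) : ‖A * B‖ ≤ a * b :=
  (Matrix.l2_opNorm_mul A B).trans
    (mul_le_mul hA hB (norm_nonneg _) ((norm_nonneg _).trans hA))

/-- The Cholesky residual of a rounded product `R = T S + F` of two triangular factors. -/
theorem norm_gram_mul_sub_le {m n : Type*} [Fintype m] [Fintype n] [DecidableEq m] [DecidableEq n]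
    {X U D : Matrix m n ℝ} {S T R E F : Matrix n n ℝ} {d e f σ τ : ℝ}
    (hD : U * S = X + D) (hE : T.transpose * T = U.transpose * U + E) (hF : R = T * S + F)
    (hDn : ‖D‖ ≤ d) (hEn : ‖E‖ ≤ e) (hFn : ‖F‖ ≤ f) (hS : ‖S‖ ≤ σ) (hT : ‖T‖ ≤ τ) :
    ‖R.transpose * R - X.transpose * X‖ ≤
      σ * e * σ + 2 * (‖X‖ * d) + d * d + 2 * (τ * σ * f) + f * f := by
  have e1 : R.transpose * R - X.transpose * X = S.transpose * E * S + X.transpose * D +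
      D.transpose * X + D.transpose * D + (T * S).transpose * F + F.transpose * (T * S) +
      F.transpose * F := by
    -- `U` enters only through `US = X + D`, so neither its departure from orthonormality nor `S⁻¹`
    -- appears in the bound.
    have h1 : S.transpose * (T.transpose * T) * S =
        (U * S).transpose * (U * S) + S.transpose * E * S := by
      rw [hE, Matrix.transpose_mul]
      simp only [Matrix.mul_add, Matrix.add_mul, Matrix.mul_assoc]
    have h2 : R.transpose * R = S.transpose * (T.transpose * T) * S + (T * S).transpose * F +
        F.transpose * (T * S) + F.transpose * F := by
      rw [hF]
      simp only [Matrix.transpose_add, Matrix.transpose_mul, Matrix.mul_add, Matrix.add_mul,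
        Matrix.mul_assoc]
      abel
    rw [h2, h1, hD]
    simp only [Matrix.transpose_add, Matrix.mul_add, Matrix.add_mul]
    abel
  have hDt : ‖D.transpose‖ ≤ d := (norm_transpose_eq D).trans_le hDn
  have hFt : ‖F.transpose‖ ≤ f := (norm_transpose_eq F).trans_le hFn
  have hTS := norm_mul_le_of_le hT hS
  have h1 := norm_mul_le_of_le (norm_mul_le_of_le ((norm_transpose_eq S).trans_le hS) hEn) hS
  have h2 := norm_mul_le_of_le (norm_transpose_eq X).le hDn
  have h3 := norm_mul_le_of_le hDt (le_refl ‖X‖)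
  have h4 := norm_mul_le_of_le hDt hDn
  have h5 := norm_mul_le_of_le ((norm_transpose_eq (T * S)).trans_le hTS) hFn
  have h6 := norm_mul_le_of_le hFt hTS
  have h7 := norm_mul_le_of_le hFt hFn
  rw [e1]
  refine (norm_add_le _ _).trans ?_
  refine (add_le_add (norm_add_le _ _) le_rfl).trans ?_
  refine (add_le_add (add_le_add (norm_add_le _ _) le_rfl) le_rfl).trans ?_
  have h8 := norm_add₄_le (a := S.transpose * E * S) (b := X.transpose * D)
    (c := D.transpose * X) (d := D.transpose * D)
  linarith

/-- Fits the conditioning of `U` into the allowance `(1 + c₁ε)κ`. If `κ ≤ 2`, then `3δ` is at most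
`4320 Mκ`; if `κ ≥ 2`, then `1 + 3δ < 2 ≤ κ` already. -/
theorem cond_bound_of_near_orthonormal {M κ δ : ℝ} (hM : 0 ≤ M) (hκ : 1 ≤ κ)
    (hδ : δ = 720 * (M * κ ^ 2)) (hMκ : M * κ ^ 2 ≤ 1 / 200000) :
    (1 + δ) / (1 - δ) ≤ (1 + 10000 * M) * κ := by
  have h0 : 0 ≤ M * κ ^ 2 := by positivity
  have h1 : (1 + δ) / (1 - δ) ≤ 1 + 3 * δ := by
    rw [div_le_iff₀ (by linarith)]
    nlinarith
  refine h1.trans ?_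
  rcases le_total κ 2 with h | h
  · have h2 : M * κ ^ 2 ≤ M * (κ * 2) := by
      rw [sq]
      gcongr
    have h3 : 0 ≤ M * κ := by positivity
    linarith
  · have : 0 ≤ M * κ := by positivity
    linarith

theorem FlPIPPlus.gram_sub_le {m p s : ℕ} (hp : 0 < p) (hs : 0 < s) {ε a N : ℝ} (hε : 0 ≤ ε)
    (ha : 0 ≤ a) (hN : 1 + m + (p * s : ℕ) + a ≤ N)
    {intraOrtho : Matrix (Fin m) (Fin s) ℝ → Matrix (Fin m) (Fin s) ℝ × Matrix (Fin s) (Fin s) ℝ}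
    {X Q : Matrix (Fin m) (Fin p × Fin s) ℝ} {R : Matrix (Fin p × Fin s) (Fin p × Fin s) ℝ}
    (hσ : 0 < sigmaMin X) (hκ : N ^ 9 * ε * (‖X‖ / sigmaMin X) ^ 2 ≤ 1 / 200000)
    (hintra : ∀ Y : Matrix (Fin m) (Fin s) ℝ,
      cond Y ≤ ENNReal.ofReal ((1 + 10000 * (N ^ 9 * ε)) * (‖X‖ / sigmaMin X)) →
      IntraOrthoAccurate (a * ε) intraOrtho Y)
    (h : FlPIPPlus ε intraOrtho X Q R) :
    ‖R.transpose * R - X.transpose * X‖ ≤ 10000 * N ^ 15 * ε * ‖X‖ ^ 2 := by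
  obtain ⟨U, S, T, hXU, hUQ, hR⟩ := h
  have : Nonempty (Fin p × Fin s) := ⟨(⟨0, hp⟩, ⟨0, hs⟩)⟩
  have hm0 : (0 : ℝ) ≤ m := Nat.cast_nonneg m
  have hn0 : (0 : ℝ) ≤ (p * s : ℕ) := Nat.cast_nonneg _
  have hN1 : 1 ≤ N := by linarith
  have hX0 := norm_nonneg X
  have hκ1 : 1 ≤ ‖X‖ / sigmaMin X := (one_le_div hσ).2 (sigmaMin_le_norm X)
  set κ := ‖X‖ / sigmaMin X with hκdef
  have hM : N ^ 9 * ε ≤ 1 / 200000 := by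
    refine le_trans (le_mul_of_one_le_right (by positivity) ?_) hκ
    exact one_le_pow₀ hκ1
  have hpow : ∀ k ≤ 9, N ^ k * ε ≤ 1 / 200000 := fun k hk =>
    le_trans (mul_le_mul_of_nonneg_right (pow_le_pow_right₀ hN1 hk) hε) hM
  have hM0 : 0 ≤ N ^ 9 * ε := by positivity
  have hNε : 160 * N * ε ≤ 1 := by
    have := hpow 1 (by norm_num)
    rw [pow_one] at this
    linarith
  obtain ⟨hSe, -, hDn, hU⟩ := hXU.error_bounds hp hs hε ha hN
    (fun k _ => hintra _ ((cond_blockCol_le hs hσ le_rfl (sigmaMin_mul_norm_le X) k).trans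
      (ENNReal.ofReal_le_ofReal (le_mul_of_one_le_left (by positivity) (by linarith))))) hσ (by
        rw [hκdef, div_pow, mul_div_assoc', div_le_iff₀ (by positivity)] at hκ
        linarith [sq_nonneg (sigmaMin X)])
  obtain ⟨δ, hδ⟩ : ∃ δ, δ = 720 * (N ^ 9 * ε * κ ^ 2) := ⟨_, rfl⟩
  have hδ0 : 0 ≤ δ := by rw [hδ]; positivity
  have hδ1 : δ ≤ 1 / 100 := by linarith
  have hUabs : ∀ w, |‖Matrix.toEuclideanLin U w‖ - ‖w‖| ≤ δ * ‖w‖ := fun w => by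
    refine (hU w).trans_eq ?_
    rw [hδ]
    ring
  have hUn : ‖U‖ ≤ 1 + δ := norm_le_of_forall_toEuclideanLin_le (by linarith) fun w => by
    linarith [(abs_le.1 (hUabs w)).2]
  have hUlow : ∀ w, (1 - δ) * ‖w‖ ≤ ‖Matrix.toEuclideanLin U w‖ := fun w => by
    linarith [(abs_le.1 (hUabs w)).1]
  have hUσ : 1 - δ ≤ sigmaMin U := le_sigmaMin hUlow
  have hU2 : ‖U‖ ≤ 2 := by linarith
  have hU0 := norm_nonneg U
  obtain ⟨hTe, hEn, -, -⟩ := hUQ.error_bounds hp hs hε ha hN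
    (fun k _ => hintra _ ((cond_blockCol_le hs (by linarith) hUn hUlow k).trans
      (ENNReal.ofReal_le_ofReal (cond_bound_of_near_orthonormal hM0 hκ1 hδ hκ)))) (by linarith) (by
        have h1 : ‖U‖ ^ 2 ≤ 2 ^ 2 := by gcongr
        have h2 : (99 / 100) ^ 2 ≤ sigmaMin U ^ 2 := by
          gcongr
          linarith
        have h3 : N ^ 9 * ε * ‖U‖ ^ 2 ≤ 1 / 200000 * 2 ^ 2 := by gcongr
        linarith)
  have hcard : (Fintype.card (Fin p × Fin s) : ℝ) ≤ N := by
    simp only [Fintype.card_prod, Fintype.card_fin]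
    linarith
  have hSn : ‖S‖ ≤ 2 * N ^ 3 * ‖X‖ := by
    refine (norm_le_of_forall_abs_entry_le hSe).trans ?_
    calc _ ≤ N * N * (2 * N * ‖X‖) := by gcongr
      _ = _ := by ring
  have hTe' : ∀ y x, |T y x| ≤ 4 * N := fun y x => by
    refine (hTe y x).trans ?_
    calc _ ≤ 2 * N * 2 := by gcongr
      _ = _ := by ring
  have hTn : ‖T‖ ≤ 4 * N ^ 3 := by
    refine (norm_le_of_forall_abs_entry_le hTe').trans ?_
    calc _ ≤ N * N * (4 * N) := by gcongr
      _ = _ := by ring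
  have hFn : ‖R - T * S‖ ≤ 32 * N ^ 6 * ε * ‖X‖ := by
    have hg := errorBound_of_dimensions hε ha hN hNε
    refine (norm_le_of_forall_abs_entry_le (c := 4 * N * ε * (N * (4 * N * (2 * N * ‖X‖))))
      fun y x => ?_).trans ?_
    · refine ((hR y x).abs_sub_le hg (by simp; omega)).trans ?_
      gcongr
      exact sum_le_mul_of_card_le hcard (by positivity) fun z =>
        mul_le_mul (hTe' y z) (hSe z x) (abs_nonneg _) (by positivity)
    · calc _ ≤ N * N * (4 * N * ε * (N * (4 * N * (2 * N * ‖X‖)))) := by gcongr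
        _ = _ := by ring
  have hEn' : ‖T.transpose * T - U.transpose * U‖ ≤ 1200 * N ^ 9 * ε := by
    refine hEn.trans ?_
    calc _ ≤ 300 * N ^ 9 * ε * 2 ^ 2 := by gcongr
      _ = _ := by ring
  refine (norm_gram_mul_sub_le (U := U) (S := S) (T := T) (D := U * S - X)
    (E := T.transpose * T - U.transpose * U) (F := R - T * S) (by abel) (by abel) (by abel)
    hDn hEn' hFn hSn hTn).trans ?_
  -- The dominant term is `SᵀE'S`, of order `N ^ (3 + 9 + 3)`. The squares of `D` and `F` are second
  -- order in `ε`, and one factor is absorbed by `hpow`.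
  have hp15 : ∀ k ≤ 15, N ^ k * (ε * ‖X‖ ^ 2) ≤ N ^ 15 * (ε * ‖X‖ ^ 2) := fun k hk =>
    mul_le_mul_of_nonneg_right (pow_le_pow_right₀ hN1 hk) (by positivity)
  have h1 := hp15 8 (by norm_num)
  have h2 := hp15 12 (by norm_num)
  have h3 := hp15 6 (by norm_num)
  have h4 : N ^ 8 * ε * (N ^ 8 * (ε * ‖X‖ ^ 2)) ≤ 1 / 200000 * (N ^ 8 * (ε * ‖X‖ ^ 2)) := by
    gcongr
    exact hpow 8 (by norm_num)
  have h5 : N ^ 6 * ε * (N ^ 6 * (ε * ‖X‖ ^ 2)) ≤ 1 / 200000 * (N ^ 6 * (ε * ‖X‖ ^ 2)) := by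
    gcongr
    exact hpow 6 (by norm_num)
  have h6 : 0 ≤ N ^ 15 * (ε * ‖X‖ ^ 2) := by positivity
  linarith

/-! ### The polynomial constants and the extended-real conditioning hypothesis. -/

/-- The polynomial `c (1 + x + y + z) ^ k`. -/
def dimPoly (c : ℝ) (k : ℕ) : MvPolynomial (Fin 3) ℝ :=
  MvPolynomial.C c * (1 + MvPolynomial.X 0 + MvPolynomial.X 1 + MvPolynomial.X 2) ^ k

theorem eval_dimPoly (c x y z : ℝ) (k : ℕ) :
    MvPolynomial.eval ![x, y, z] (dimPoly c k) = c * (1 + x + y + z) ^ k := by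
  simp [dimPoly]

/-- Positivity of `c` excludes `cond A = ⊤`, where the product would be infinite; the hypothesis
then becomes one about real numbers. -/
theorem sigmaMin_pos_of_cond_le {m n : Type*} [Fintype m] [Fintype n] [DecidableEq n]
    {A : Matrix m n ℝ} {c : ℝ} (hc : 0 < c) (h : ENNReal.ofReal c * cond A ^ 2 ≤ 1 / 2) :
    0 < sigmaMin A ∧ cond A = ENNReal.ofReal (‖A‖ / sigmaMin A) ∧
      c * (‖A‖ / sigmaMin A) ^ 2 ≤ 1 / 2 := by
  have h0 : sigmaMin A ≠ 0 := by
    intro h0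
    rw [cond, if_pos h0, ENNReal.top_pow two_ne_zero,
      ENNReal.mul_top (ENNReal.ofReal_pos.2 hc).ne', top_le_iff] at h
    exact absurd h (by simp)
  have hκ : cond A = ENNReal.ofReal (‖A‖ / sigmaMin A) := by rw [cond, if_neg h0]
  have hpos := (sigmaMin_nonneg A).lt_of_ne h0.symm
  refine ⟨hpos, hκ, ?_⟩
  have h12 : (1 / 2 : ENNReal) = ENNReal.ofReal (1 / 2) := by
    rw [ENNReal.ofReal_div_of_pos (by norm_num)]
    simp
  rw [hκ, ← ENNReal.ofReal_pow (by positivity), ← ENNReal.ofReal_mul hc.le, h12] at h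
  exact (ENNReal.ofReal_le_ofReal_iff (by norm_num)).1 h

end BlockGS

end

theorem mainTheorem7 :
    ∃ c₀ c₁ C : MvPolynomial (Fin 3) ℝ,
      ∀ (m p s : ℕ) (_hp : 0 < p) (_hs : 0 < s) (_hm : p * s ≤ m)
        (ε a : ℝ) (_hε : 0 < ε) (_ha : 0 ≤ a)
        (intraOrtho : Matrix (Fin m) (Fin s) ℝ → Matrix (Fin m) (Fin s) ℝ × Matrix (Fin s) (Fin s) ℝ)
        (X Q : Matrix (Fin m) (Fin p × Fin s) ℝ)
        (R : Matrix (Fin p × Fin s) (Fin p × Fin s) ℝ),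
        ENNReal.ofReal (MvPolynomial.eval ![(m : ℝ), ((p * s : ℕ) : ℝ), a] c₀ * ε) *
            BlockGS.cond X ^ 2 ≤ 1 / 2 →
        (∀ Y : Matrix (Fin m) (Fin s) ℝ,
          BlockGS.cond Y ≤
              ENNReal.ofReal (1 + MvPolynomial.eval ![(m : ℝ), ((p * s : ℕ) : ℝ), a] c₁ * ε) *
                BlockGS.cond X →
          BlockGS.IntraOrthoAccurate (a * ε) intraOrtho Y) →
        BlockGS.FlPIPPlus ε intraOrtho X Q R →
        ∃ ΔE : Matrix (Fin p × Fin s) (Fin p × Fin s) ℝ,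
          R.transpose * R = X.transpose * X + ΔE ∧
          ‖ΔE‖ ≤ MvPolynomial.eval ![(m : ℝ), ((p * s : ℕ) : ℝ), a] C * ε * ‖X‖ ^ 2 := by
  -- With 100000, the bound `1/2` is exactly `N ^ 9 * ε * κ² ≤ 1 / 200000`.
  refine ⟨BlockGS.dimPoly 100000 9, BlockGS.dimPoly 10000 9, BlockGS.dimPoly 10000 15, ?_⟩
  intro m p s hp hs _ ε a hε ha intraOrtho X Q R hcond hintra h
  simp only [BlockGS.eval_dimPoly] at hcond hintra ⊢
  obtain ⟨N, hN⟩ : ∃ N : ℝ, N = 1 + m + (p * s : ℕ) + a := ⟨_, rfl⟩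
  rw [← hN] at hcond ⊢
  simp only [← hN] at hintra
  have hN0 : 0 < N := by rw [hN]; positivity
  obtain ⟨hσ, hκ, hκ2⟩ := BlockGS.sigmaMin_pos_of_cond_le (by positivity) hcond
  refine ⟨R.transpose * R - X.transpose * X, by abel, ?_⟩
  refine h.gram_sub_le hp hs hε.le ha hN.ge hσ (by linarith) fun Y hY => hintra Y ?_
  rw [hκ, ← ENNReal.ofReal_mul (by positivity)]
  convert hY using 3
  ring
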